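/- Let $p$ be a prime and let $\mathbb{F}_q$ be a finite field with $q=p^d$ elements, $q\neq 2,3,5$. Let $(\mathbb{T},\mathfrak{m}_{\mathbb{T}})$ be a finite-dimensional local commutative $\mathbb{F}_q$-algebra, equipped with the discrete topology, with residue field $\mathbb{T}/\mathfrak{m}_{\mathbb{T}}\simeq\mathbb{F}_q$ and with $\mathfrak{m}_{\mathbb{T}}^2=0$. For a subgroup $D\subseteq\mathbb{F}_q^\times$ and an $\mathbb{F}_q$-algebra $R$, let $\mathrm{GL}_2^D(R)$ be the group of $g\in\mathrm{GL}_2(R)$ whose determinant lies in the image of $D$ in $R^\times$. Let $\mathrm{M}_2^0(\mathbb{F}_q)$ and $\mathrm{M}_2^0(\mathfrak{m}_{\mathbb{T}})$ denote the groups of trace-$0$ $2\times 2$ matrices with entries in $\mathbb{F}_q$ and in $\mathfrak{m}_{\mathbb{T}}$, regarded as $\mathbb{F}_p[\mathrm{GL}_2^D(\mathbb{F}_q)]$-modules by conjugation; semidirect products are formed with respect to these actions. Let $\Gamma$ be a profinite group, let $\rho:\Gamma\to\mathrm{GL}_2(\mathbb{T})$ be a continuous representation and let $\overline{\rho}$ be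 its reduction modulo $\mathfrak{m}_{\mathbb{T}}$. Suppose that, for some subgroup $D\subseteq\mathbb{F}_q^\times$ (necessarily $D=\mathrm{Im}(\det\circ\overline{\rho})$), (a) $\mathrm{Im}(\overline{\rho})=\mathrm{GL}_2^D(\mathbb{F}_q)$; (b) $\mathrm{Im}(\rho)\subseteq\mathrm{GL}_2^D(\mathbb{T})$; (c) $\mathbb{T}$ is generated as an $\mathbb{F}_q$-algebra by the set of traces of $\rho$. Let $m:=\dim_{\mathbb{F}_q}\mathfrak{m}_{\mathbb{T}}$ and let $t$ be the number of different traces of elements of $\mathrm{Im}(\rho)$. If $p\neq 2$, then $t=q^{m+1}$ and, as groups, $$\mathrm{Im}(\rho)\simeq \mathrm{M}_2^0(\mathbb{F}_q)^{m}\rtimes\mathrm{GL}_2^D(\mathbb{F}_q)\simeq\mathrm{GL}_2^D(\mathbb{T}).$$ If $p=2$, then $t=q^\alpha\cdot((q-1)2^\beta+1)$ for some integers $0\le\alpha\le m$ and $0\le\beta\le d(m-\alpha)$, and $\alpha,\beta$ are the only non-negative integers satisfying this equation. Moreover, there is an $\mathbb{F}_2[\mathrm{GL}_2^D(\mathbb{F}_q)]$-submodule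 $M\subseteq\mathrm{M}_2^0(\mathfrak{m}_{\mathbb{T}})$ with $\mathrm{Im}(\rho)\simeq M\rtimes\mathrm{GL}_2^D(\mathbb{F}_q)$ as groups and, as modules, $$M\simeq \mathrm{M}_2^0(\mathbb{F}_q)^{\alpha}\oplus C_2^{\beta},$$ where $C_2\subseteq\mathrm{M}_2^0(\mathbb{F}_q)$ is a subgroup of order $2$ of the scalar matrices. The module $M$ is determined by $t$ up to isomorphism: every submodule $M\subseteq\mathrm{M}_2^0(\mathfrak{m}_{\mathbb{T}})$ with $\mathrm{Im}(\rho)\simeq M\rtimes\mathrm{GL}_2^D(\mathbb{F}_q)$ is isomorphic to $\mathrm{M}_2^0(\mathbb{F}_q)^{\alpha}\oplus C_2^{\beta}$ for this same pair $(\alpha,\beta)$. -/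

import Mathlib

namespace TraceImage

/-- For a field `k`, a subgroup `D` of `kˣ` and a `k`-algebra `R`, the group `GL₂ᴰ(R)` of the
invertible `2 × 2` matrices over `R` whose determinant lies in (the image in `Rˣ` of) `D`. -/
def GL2D {k : Type*} [Field k] (D : Subgroup kˣ) (R : Type*) [CommRing R] [Algebra k R] :
    Subgroup (GL (Fin 2) R) :=
  (D.map (Units.map (algebraMap k R : k →* R))).comap Matrix.GeneralLinearGroup.det

/-- `M₂⁰(I)`: the trace-zero `2 × 2` matrices with entries in an ideal `I` of `R`, as a vector
space over the prime field `𝔽_p`. With `I = ⊤` this is `M₂⁰(R)`. -/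
def M20 (p : ℕ) {R : Type*} [CommRing R] [Algebra (ZMod p) R] (I : Ideal R) :
    Submodule (ZMod p) (Matrix (Fin 2) (Fin 2) R) where
  carrier := {A | (∀ i j, A i j ∈ I) ∧ A.trace = 0}
  add_mem' := fun ha hb =>
    ⟨fun i j => I.add_mem (ha.1 i j) (hb.1 i j), by rw [Matrix.trace_add, ha.2, hb.2, add_zero]⟩
  zero_mem' := ⟨fun _ _ => I.zero_mem, Matrix.trace_zero _ _⟩
  smul_mem' := fun c A hA =>
    ⟨fun i j => by
      rw [Matrix.smul_apply, Algebra.smul_def]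
      exact I.mul_mem_left _ (hA.1 i j), by rw [Matrix.trace_smul, hA.2, smul_zero]⟩

theorem conj_mem_M20 (p : ℕ) {R : Type*} [CommRing R] [Algebra (ZMod p) R] {I : Ideal R}
    (g : GL (Fin 2) R) {A : Matrix (Fin 2) (Fin 2) R} (hA : A ∈ M20 p I) :
    (g : Matrix (Fin 2) (Fin 2) R) * A * ((g⁻¹ : GL (Fin 2) R) : Matrix (Fin 2) (Fin 2) R)
      ∈ M20 p I := by
  refine ⟨fun i j => ?_, ?_⟩
  · rw [Matrix.mul_apply]
    refine I.sum_mem fun l _ => I.mul_mem_right _ ?_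
    rw [Matrix.mul_apply]
    exact I.sum_mem fun l' _ => I.mul_mem_left _ (hA.1 _ _)
  · rw [Matrix.trace_mul_comm, ← mul_assoc, Units.inv_mul, one_mul]
    exact hA.2

/-- The conjugation action of `GL₂ᴰ(k)` on `M₂⁰(I)`, for an ideal `I` of a `k`-algebra `R`:
`g` sends `A` to `g A g⁻¹`, where `g` is viewed in `GL₂(R)`. -/
def conjRep (p : ℕ) {k : Type*} [Field k] (D : Subgroup kˣ) {R : Type*} [CommRing R]
    [Algebra k R] [Algebra (ZMod p) R] (I : Ideal R) :
    Representation (ZMod p) (GL2D D k) (M20 p I) where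
  toFun g :=
    { toFun := fun A =>
        ⟨(Matrix.GeneralLinearGroup.map (algebraMap k R) (g : GL (Fin 2) k) :
            Matrix (Fin 2) (Fin 2) R) * (A : Matrix (Fin 2) (Fin 2) R) *
          (((Matrix.GeneralLinearGroup.map (algebraMap k R) (g : GL (Fin 2) k))⁻¹ :
            GL (Fin 2) R) : Matrix (Fin 2) (Fin 2) R), conj_mem_M20 p _ A.2⟩
      map_add' := fun A B => Subtype.ext (by
        simp only [Submodule.coe_add, mul_add, add_mul])
      map_smul' := fun c A => Subtype.ext (by
        simp only [Submodule.coe_smul, Algebra.mul_smul_comm, Algebra.smul_mul_assoc,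
          RingHom.id_apply]) }
  map_one' := by
    ext A : 2
    simp
  map_mul' g h := by
    ext A : 2
    simp [mul_assoc]

section Reps

variable {K G V : Type*} [CommRing K] [Group G] [AddCommGroup V] [Module K V]

/-- The direct sum `V ⊕ ⋯ ⊕ V` of `n` copies of a representation. -/
def copies (n : ℕ) (σ : Representation K G V) : Representation K G (Fin n → V) where
  toFun g := (σ g).compLeft (Fin n)
  map_one' := by
    ext v i
    simp
  map_mul' g h := by
    ext v i
    simp

/-- The action of `G` on a representation `V`, by automorphisms of the additive group of `V`
written multiplicatively. -/
def repAut (σ : Representation K G V) : G →* MulAut (Multiplicative V) where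
  toFun g :=
    { toFun := fun v => Multiplicative.ofAdd (σ g v.toAdd)
      invFun := fun v => Multiplicative.ofAdd (σ g⁻¹ v.toAdd)
      left_inv := fun v => by simp
      right_inv := fun v => by simp
      map_mul' := fun v w => by simp }
  map_one' := by
    ext v
    simp
  map_mul' g h := by
    ext v
    simp

/-- The semidirect product `V ⋊ G` of the additive group of a representation `V` of `G` by `G`. -/
abbrev RepSemidirect (σ : Representation K G V) : Type _ :=
  Multiplicative V ⋊[repAut σ] G

end Reps

/-- A representation `σ` of `GL₂ᴰ(k)` over `𝔽_p` is of type `(α, β)` if it is isomorphic to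
`M₂⁰(k)^α ⊕ C^β`, where `C ⊆ M₂⁰(k)` is a subgroup of order `p` consisting of scalar matrices. -/
def IsOfType (p : ℕ) {k : Type*} [Field k] [Algebra (ZMod p) k] (D : Subgroup kˣ)
    {V : Type*} [AddCommGroup V] [Module (ZMod p) V]
    (σ : Representation (ZMod p) (GL2D D k) V) (α β : ℕ) : Prop :=
  ∃ C : Subrepresentation (conjRep p D (⊤ : Ideal k)),
    (∀ A ∈ C.toSubmodule, ∃ c : k, (A : Matrix (Fin 2) (Fin 2) k) = Matrix.scalar (Fin 2) c) ∧
    Nat.card C.toSubmodule = p ∧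
    Nonempty (σ.Equiv
      ((copies α (conjRep p D (⊤ : Ideal k))).prod (copies β C.toRepresentation)))

end TraceImage

open TraceImage

/-! Write `𝔪` for the square-zero maximal ideal, `π : T → k` for the reduction and `G` for the image
of `ρ`. The matrices `A` over `𝔪` with `1 + A ∈ G` form an additive group `N`. It consists of
trace-zero matrices, because `det (1 + A) = 1 + tr A` must lie in `D`, and it is stable under
conjugation by `GL₂ᴰ(k)`, because `𝔪² = 0`.

Stability forces a rigid shape (`IsStable.mem_iff`): `N` consists of the trace-zero matrices with
off-diagonal entries in a `k`-subspace `W` and diagonal entries in an additive group `X`, where `2X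
⊆ W ⊆ X`. In odd characteristic `X = W`; in characteristic two `X` may be any group between `W` and
`𝔪`, and the excess `X / W` gives scalar matrices.

The extension of `GL₂ᴰ(k)` by `N` splits. A set-theoretic section of `G → GL₂ᴰ(k)` differs from the
constant matrices by a cocycle modulo `N`. Over `T / W` the group `N` becomes a group of scalars
killed by two, and `exists_coboundary` shows that the cocycle is a coboundary there. The bounding
matrix `v` is allowed a nonzero trace; this is harmless, since conjugation by any `1 + v` preserves
determinants. Lifting `v` and conjugating puts `GL₂ᴰ(k)` inside `G` (`SquareZero.exists_conj_le`),
so `G ≃ N ⋊ GL₂ᴰ(k)`.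

The traces of `G` are then explicit. If `p ≠ 2` they lie in `k + W`, so the generation hypothesis
gives `W = 𝔪` and `G = GL₂ᴰ(T)`. If `p = 2` they are the elements of `W` and the `a (1 + y)` with `a
∈ kˣ`, `y ∈ X`. With `|W| = q^α` and `|X| = |W| 2^β` this gives the formula for `t`, whose odd part
and power of two recover `α` and `β`. The semidirect product recovers `|X|` from its center and then
`|W|` from its order, so every admissible `M` has the same type. -/

namespace TraceImage

open Matrix

/-! ### Generators and relations of `GL₂ᴰ(k)` -/

section Elements

variable {k : Type*} [Field k]

/-- The upper unipotent element `[1, x; 0, 1]`. -/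
def upperUnip (x : k) : GL (Fin 2) k :=
  ⟨!![1, x; 0, 1], !![1, -x; 0, 1], by simp [Matrix.one_fin_two], by simp [Matrix.one_fin_two]⟩

/-- The Weyl element `[0, 1; -1, 0]`. -/
def weyl : GL (Fin 2) k :=
  ⟨!![0, 1; -1, 0], !![0, -1; 1, 0], by simp [Matrix.one_fin_two], by simp [Matrix.one_fin_two]⟩

/-- The diagonal element `[a, 0; 0, d]`. -/
def diagHom : kˣ × kˣ →* GL (Fin 2) k where
  toFun a := ⟨!![(a.1 : k), 0; 0, (a.2 : k)], !![((a.1⁻¹ : kˣ) : k), 0; 0, ((a.2⁻¹ : kˣ) : k)],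
    by simp [Matrix.one_fin_two], by simp [Matrix.one_fin_two]⟩
  map_one' := by
    ext i j
    fin_cases i <;> fin_cases j <;> simp
  map_mul' a b := by
    ext i j
    fin_cases i <;> fin_cases j <;> simp

@[simp] theorem coe_upperUnip (x : k) :
    (upperUnip x : Matrix (Fin 2) (Fin 2) k) = !![1, x; 0, 1] := rfl

@[simp] theorem coe_inv_upperUnip (x : k) :
    (((upperUnip x)⁻¹ : GL (Fin 2) k) : Matrix (Fin 2) (Fin 2) k) = !![1, -x; 0, 1] := rfl

@[simp] theorem coe_weyl : ((weyl : GL (Fin 2) k) : Matrix (Fin 2) (Fin 2) k) =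
    !![0, 1; -1, 0] := rfl

@[simp] theorem coe_inv_weyl :
    (((weyl : GL (Fin 2) k)⁻¹ : GL (Fin 2) k) : Matrix (Fin 2) (Fin 2) k) = !![0, -1; 1, 0] := rfl

@[simp] theorem coe_diagHom (a : kˣ × kˣ) :
    (diagHom a : Matrix (Fin 2) (Fin 2) k) = !![(a.1 : k), 0; 0, (a.2 : k)] := rfl

@[simp] theorem coe_inv_diagHom (a : kˣ × kˣ) :
    (((diagHom a)⁻¹ : GL (Fin 2) k) : Matrix (Fin 2) (Fin 2) k) =
      !![((a.1⁻¹ : kˣ) : k), 0; 0, ((a.2⁻¹ : kˣ) : k)] := rfl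

theorem mem_GL2D_self {D : Subgroup kˣ} {g : GL (Fin 2) k} :
    g ∈ GL2D D k ↔ Matrix.GeneralLinearGroup.det g ∈ D := by
  have : Units.map (algebraMap k k : k →* k) = MonoidHom.id kˣ := by
    ext; rfl
  rw [GL2D, Subgroup.mem_comap, this, Subgroup.map_id]

theorem mem_GL2D_self_of_det_eq_one {D : Subgroup kˣ} {g : GL (Fin 2) k}
    (h : (g : Matrix (Fin 2) (Fin 2) k).det = 1) : g ∈ GL2D D k := by
  rw [mem_GL2D_self]
  have : Matrix.GeneralLinearGroup.det g = 1 := Units.ext h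
  rw [this]
  exact D.one_mem

variable (D : Subgroup kˣ)

/-- The upper unipotent element as an element of `GL₂ᴰ`. -/
def upperUnipD (x : k) : GL2D D k :=
  ⟨upperUnip x, mem_GL2D_self_of_det_eq_one (by simp)⟩

/-- The Weyl element as an element of `GL₂ᴰ`. -/
def weylD : GL2D D k := ⟨weyl, mem_GL2D_self_of_det_eq_one (by simp [Matrix.det_fin_two])⟩

/-- The pairs of units whose product lies in `D`. -/
def diagPairs : Subgroup (kˣ × kˣ) :=
  D.comap (MonoidHom.coprod (MonoidHom.id kˣ) (MonoidHom.id kˣ))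

/-- The diagonal torus of `GL₂ᴰ`. -/
def torusD : diagPairs D →* GL2D D k :=
  (diagHom.comp (diagPairs D).subtype).codRestrict (GL2D D k) (fun a => by
    rw [mem_GL2D_self]
    have h : Matrix.GeneralLinearGroup.det (diagHom (a : kˣ × kˣ)) =
        (a : kˣ × kˣ).1 * (a : kˣ × kˣ).2 := by
      ext
      simp
    exact h ▸ a.2)

/-- The element `diag(a, a⁻¹)` of the torus. -/
def antiDiag (a : kˣ) : diagPairs D := ⟨(a, a⁻¹), by simp [diagPairs]⟩

@[simp] theorem coe_upperUnipD (x : k) : (upperUnipD D x : GL (Fin 2) k) = upperUnip x := rfl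
@[simp] theorem coe_weylD : (weylD D : GL (Fin 2) k) = weyl := rfl
@[simp] theorem coe_torusD (a : diagPairs D) : (torusD D a : GL (Fin 2) k) = diagHom a := rfl
@[simp] theorem coe_antiDiag (a : kˣ) : (antiDiag D a : kˣ × kˣ) = (a, a⁻¹) := rfl

theorem GL2D_ext {D : Subgroup kˣ} {g h : GL2D D k}
    (H : ∀ i j, (g : GL (Fin 2) k) i j = (h : GL (Fin 2) k) i j) : g = h :=
  Subtype.ext (Units.ext (Matrix.ext H))

theorem upperUnipD_add (x y : k) : upperUnipD D (x + y) = upperUnipD D x * upperUnipD D y := by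
  apply GL2D_ext
  intro i j
  fin_cases i <;> fin_cases j <;> simp [add_comm]

theorem torusD_conj_upperUnipD (a : kˣ) (x : k) :
    torusD D (antiDiag D a) * upperUnipD D x * torusD D (antiDiag D a⁻¹) =
      upperUnipD D ((a : k) ^ 2 * x) := by
  apply GL2D_ext
  intro i j
  fin_cases i <;> fin_cases j <;> simp
  ring

/-- This relation controls the off-diagonal entries of a cocycle at the Weyl element; the next one
controls its diagonal entries. -/
theorem torusD_mul_weylD (a : kˣ) :
    torusD D (antiDiag D a) * weylD D * torusD D (antiDiag D a) = weylD D := by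
  apply GL2D_ext
  intro i j
  fin_cases i <;> fin_cases j <;> simp

theorem weylD_braid :
    weylD D * upperUnipD D (-1) * weylD D = upperUnipD D 1 * weylD D * upperUnipD D 1 := by
  apply GL2D_ext
  intro i j
  fin_cases i <;> fin_cases j <;> simp

/-- Bruhat decomposition: `GL₂ᴰ` is generated by the torus, the upper unipotents and the Weyl
element. -/
theorem GL2D_eq_top_of_generators (K : Subgroup (GL2D D k)) (hu : ∀ x, upperUnipD D x ∈ K)
    (hw : weylD D ∈ K) (ht : ∀ a, torusD D a ∈ K) : K = ⊤ := by
  rw [eq_top_iff]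
  intro g _
  set a := (g : GL (Fin 2) k) 0 0 with ha
  set b := (g : GL (Fin 2) k) 0 1 with hb
  set c := (g : GL (Fin 2) k) 1 0 with hc
  set d := (g : GL (Fin 2) k) 1 1 with hd
  have hdet : ((Matrix.GeneralLinearGroup.det (g : GL (Fin 2) k) : kˣ) : k) = a * d - b * c := by
    simp [Matrix.det_fin_two, ha, hb, hc, hd]
  have hgD := mem_GL2D_self.1 g.2
  set δ := Matrix.GeneralLinearGroup.det (g : GL (Fin 2) k) with hδ
  by_cases hc0 : c = 0
  · have hδ0 : (δ : k) ≠ 0 := δ.ne_zero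
    rw [hdet, hc0, mul_zero, sub_zero] at hδ0
    have ha0 : a ≠ 0 := left_ne_zero_of_mul hδ0
    have hd0 : d ≠ 0 := right_ne_zero_of_mul hδ0
    have hmem : (Units.mk0 a ha0, Units.mk0 d hd0) ∈ diagPairs D := by
      simp only [diagPairs, Subgroup.mem_comap, MonoidHom.coprod_apply, MonoidHom.id_apply]
      convert hgD
      ext
      simp [hdet, hc0]
    have : g = torusD D ⟨_, hmem⟩ * upperUnipD D (b / a) := by
      apply GL2D_ext
      intro i j
      fin_cases i <;> fin_cases j <;> simp <;> simp [← ha, ← hb, ← hc, ← hd, hc0]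
      field_simp
    rw [this]
    exact K.mul_mem (ht _) (hu _)
  -- The big Bruhat cell: the torus element times the Weyl element must be `[0, -δ/c; c, 0]`.
  · have hmem : (-δ * (Units.mk0 c hc0)⁻¹, -Units.mk0 c hc0) ∈ diagPairs D := by
      simp only [diagPairs, Subgroup.mem_comap, MonoidHom.coprod_apply, MonoidHom.id_apply]
      convert hgD
      simp
    have : g = upperUnipD D (a / c) * torusD D ⟨_, hmem⟩ * weylD D * upperUnipD D (d / c) := by
      apply GL2D_ext
      intro i j
      fin_cases i <;> fin_cases j <;> simp <;> simp [← ha, ← hb, ← hc, ← hd, hdet] <;> field_simp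
      ring
    rw [this]
    exact K.mul_mem (K.mul_mem (K.mul_mem (hu _) (ht _)) hw) (hu _)

end Elements

/-! ### Conjugation by constant matrices -/

section Conj

variable {k : Type*} [Field k] {R : Type*} [CommRing R] [Algebra k R]

variable (R) in
/-- The conjugation action of `GL₂(k)` on the `2 × 2` matrices over a `k`-algebra. -/
def conj : Representation k (GL (Fin 2) k) (Matrix (Fin 2) (Fin 2) R) where
  toFun g :=
    { toFun := fun A => (Matrix.GeneralLinearGroup.map (algebraMap k R) g :
            Matrix (Fin 2) (Fin 2) R) * A *
          (((Matrix.GeneralLinearGroup.map (algebraMap k R) g)⁻¹ :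
            GL (Fin 2) R) : Matrix (Fin 2) (Fin 2) R)
      map_add' := fun A B => by simp only [mul_add, add_mul]
      map_smul' := fun c A => by
        simp only [Algebra.mul_smul_comm, Algebra.smul_mul_assoc, RingHom.id_apply] }
  map_one' := by
    ext A : 1
    simp
  map_mul' g h := by
    ext A : 1
    simp [mul_assoc]

theorem conj_apply (g : GL (Fin 2) k) (A : Matrix (Fin 2) (Fin 2) R) :
    conj R g A = (Matrix.GeneralLinearGroup.map (algebraMap k R) g :
            Matrix (Fin 2) (Fin 2) R) * A *
          (((Matrix.GeneralLinearGroup.map (algebraMap k R) g)⁻¹ :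
            GL (Fin 2) R) : Matrix (Fin 2) (Fin 2) R) := rfl

/-- The coefficients lie in `k`, so conjugation preserves matrices over any `k`-subspace and
commutes with `k`-linear maps applied entrywise. -/
theorem conj_entries (g : GL (Fin 2) k) (A : Matrix (Fin 2) (Fin 2) R) (i j : Fin 2) :
    conj R g A i j = ∑ l, ∑ l', ((g : GL (Fin 2) k) i l' *
      (g⁻¹ : GL (Fin 2) k) l j) • A l' l := by
  rw [conj_apply, ← map_inv]
  simp only [Matrix.mul_apply, Finset.sum_mul, Algebra.smul_def, map_mul]
  refine Finset.sum_congr rfl fun l _ => Finset.sum_congr rfl fun l' _ => ?_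
  simp only [Matrix.GeneralLinearGroup.map_apply]
  ring

theorem conj_mem {I : Submodule k R} (g : GL (Fin 2) k) {A : Matrix (Fin 2) (Fin 2) R}
    (hA : ∀ i j, A i j ∈ I) (i j : Fin 2) : conj R g A i j ∈ I := by
  rw [conj_entries]
  exact I.sum_mem fun l _ => I.sum_mem fun l' _ => I.smul_mem _ (hA _ _)

theorem trace_conj (g : GL (Fin 2) k) (A : Matrix (Fin 2) (Fin 2) R) :
    (conj R g A).trace = A.trace := by
  rw [conj_apply, Matrix.trace_mul_comm, ← mul_assoc, Units.inv_mul, one_mul]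

theorem conj_scalar (g : GL (Fin 2) k) (x : R) :
    conj R g (Matrix.scalar (Fin 2) x) = Matrix.scalar (Fin 2) x := by
  rw [conj_apply, ← (Matrix.scalar_commute x (fun _ => Commute.all _ _) _).eq, mul_assoc,
    Units.mul_inv, mul_one]

theorem conj_upperUnip (x : k) (A : Matrix (Fin 2) (Fin 2) R) :
    conj R (upperUnip x) A = !![A 0 0 + x • A 1 0,
      A 0 1 + x • A 1 1 - x • A 0 0 - (x ^ 2) • A 1 0; A 1 0, A 1 1 - x • A 1 0] := by
  ext i j
  rw [conj_entries]
  fin_cases i <;> fin_cases j <;> simp [Fin.sum_univ_two, -Matrix.coe_units_inv] <;> module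

theorem conj_weyl (A : Matrix (Fin 2) (Fin 2) R) :
    conj R (weyl : GL (Fin 2) k) A = !![A 1 1, - A 1 0; - A 0 1, A 0 0] := by
  ext i j
  rw [conj_entries]
  fin_cases i <;> fin_cases j <;> simp [Fin.sum_univ_two, -Matrix.coe_units_inv]

theorem conj_diagHom (a : kˣ × kˣ) (A : Matrix (Fin 2) (Fin 2) R) :
    conj R (diagHom a) A = !![A 0 0, ((a.1 : k) * (a.2⁻¹ : kˣ)) • A 0 1;
      ((a.2 : k) * (a.1⁻¹ : kˣ)) • A 1 0, A 1 1] := by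
  ext i j
  rw [conj_entries]
  fin_cases i <;> fin_cases j <;> simp [Fin.sum_univ_two, -Matrix.coe_units_inv]

end Conj

/-! ### Cocycles modulo a stable subgroup -/

section CocycleMod

variable {k G A : Type*} [Field k] [Group G] [AddCommGroup A] [Module k A]

/-- A function `c : G → A` is a cocycle modulo a stable additive subgroup `S` of the
representation `A`. -/
structure IsCocycleMod (σ : Representation k G A) (S : AddSubgroup A) (c : G → A) : Prop where
  stable : ∀ g, ∀ s ∈ S, σ g s ∈ S
  mul : ∀ g h, c (g * h) - c g - σ g (c h) ∈ S

namespace IsCocycleMod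

variable {σ : Representation k G A} {S : AddSubgroup A} {c : G → A}

theorem map_one (hc : IsCocycleMod σ S c) : c 1 ∈ S := by
  have := hc.mul 1 1
  simpa using this

/-- The subgroup on which a cocycle vanishes. -/
def vanishing (hc : IsCocycleMod σ S c) : Subgroup G where
  carrier := {g | c g ∈ S}
  one_mem' := hc.map_one
  mul_mem' {g h} hg hh := by
    have := S.add_mem (S.add_mem (hc.mul g h) hg) (hc.stable g _ hh)
    show c (g * h) ∈ S
    convert this using 1
    abel
  inv_mem' {g} hg := by
    have h1 := hc.mul g⁻¹ g
    rw [inv_mul_cancel] at h1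
    have := S.sub_mem (S.sub_mem hc.map_one h1) (hc.stable g⁻¹ _ hg)
    show c g⁻¹ ∈ S
    convert this using 1
    abel

theorem mem_vanishing (hc : IsCocycleMod σ S c) {g : G} : g ∈ hc.vanishing ↔ c g ∈ S := Iff.rfl

theorem mul_left (hc : IsCocycleMod σ S c) {h : G} (hh : c h ∈ S) (g : G) :
    c (h * g) - σ h (c g) ∈ S := by
  have := S.add_mem (hc.mul h g) hh
  convert this using 1
  abel

theorem mul_right (hc : IsCocycleMod σ S c) {h : G} (hh : c h ∈ S) (g : G) :
    c (g * h) - c g ∈ S := by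
  have := S.add_mem (hc.mul g h) (hc.stable g _ hh)
  convert this using 1
  abel

theorem mul_mul (hc : IsCocycleMod σ S c) {h h' : G} (hh : c h ∈ S) (hh' : c h' ∈ S) (g : G) :
    c (h * g * h') - σ h (c g) ∈ S := by
  have := S.add_mem (hc.mul_right hh' (h * g)) (hc.mul_left hh g)
  convert this using 1
  abel

theorem sub_coboundary (hc : IsCocycleMod σ S c) (v : A) :
    IsCocycleMod σ S fun g => c g - (σ g v - v) where
  stable := hc.stable
  mul g h := by
    convert hc.mul g h using 1
    simp only [map_mul, Module.End.mul_apply, map_sub]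
    abel

theorem comp (hc : IsCocycleMod σ S c) {H : Type*} [Group H] (f : H →* G) :
    IsCocycleMod (σ.comp f) S (c ∘ f) where
  stable h := hc.stable (f h)
  mul g h := by
    simpa using hc.mul (f g) (f h)

/-- A cocycle on a finite group of order prime to the exponent of the coefficients is a
coboundary: one averages. -/
theorem exists_coboundary [Fintype G] (hc : IsCocycleMod σ S c) {p : ℕ} (hp : ∀ a : A, p • a = 0)
    (hG : (Fintype.card G).Coprime p) :
    ∃ n : ℕ, ∀ g, c g - (σ g (-(n • ∑ h, c h)) - -(n • ∑ h, c h)) ∈ S := by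
  -- `n` inverts the group order modulo `p`. If `p = 0`, coprimality makes the group trivial and `n
  -- = 1` works.
  obtain ⟨n, hn⟩ : ∃ n : ℕ, ∀ a : A, n • Fintype.card G • a = a := by
    by_cases hp0 : p = 0
    · refine ⟨1, fun a => ?_⟩
      rw [hp0, Nat.coprime_zero_right] at hG
      rw [hG, one_smul, one_smul]
    obtain ⟨n, -, hn⟩ := Nat.exists_mul_mod_eq_of_coprime 1 hG hp0
    refine ⟨n, fun a => ?_⟩
    have hmod : ∀ j : ℕ, j • a = (j % p) • a := fun j => by
      conv_lhs => rw [← Nat.mod_add_div j p, add_smul, mul_smul, hp, add_zero]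
    rw [← mul_smul, mul_comm, hmod, hn, ← hmod, one_smul]
  refine ⟨n, fun g => ?_⟩
  -- Summing the cocycle relation over `h` and reindexing by `g * h` expresses `|G| • c g` through
  -- the single element `∑ h, c h`.
  have h1 : ∑ h, (c (g * h) - c g - σ g (c h)) ∈ S := S.sum_mem fun h _ => hc.mul g h
  rw [Finset.sum_sub_distrib, Finset.sum_sub_distrib, ← map_sum, Finset.sum_const,
    Finset.card_univ, Fintype.sum_equiv (Equiv.mulLeft g) (fun h => c (g * h)) c (fun _ => rfl)]
    at h1
  have h2 := S.neg_mem (S.nsmul_mem h1 n)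
  convert h2 using 1
  rw [smul_sub, smul_sub, hn, map_neg, map_nsmul]
  abel

end IsCocycleMod

end CocycleMod

/-! ### Squares and powers in a finite field -/

section Field

variable {k : Type*} [Field k] [Finite k]

/-- The torus elements `diag(a, a⁻¹)` scale only by squares. Since squares generate `k` additively,
equivariance under them already gives `k`-linearity. -/
theorem exists_eq_sq_sub_sq (s : k) : ∃ a b : k, s = a ^ 2 - b ^ 2 := by
  by_cases h : (2 : k) = 0
  · have : CharP k 2 := CharTwo.of_one_ne_zero_of_two_eq_zero one_ne_zero h
    obtain ⟨r, hr⟩ := FiniteField.isSquare_of_char_two (ringChar.eq k 2 ▸ rfl) s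
    exact ⟨r, 0, by rw [hr]; ring⟩
  · exact ⟨(s + 1) / 2, (s - 1) / 2, by field_simp; ring⟩

/-- An additive map that is equivariant for squares is linear. -/
theorem map_smul_of_map_sq_smul {V W : Type*} [AddCommGroup V] [AddCommGroup W] [Module k V]
    [Module k W] (f : V →+ W) (hf : ∀ (a : kˣ) v, f ((a : k) ^ 2 • v) = (a : k) ^ 2 • f v)
    (s : k) (v : V) : f (s • v) = s • f v := by
  have hf' : ∀ (a : k) v, f (a ^ 2 • v) = a ^ 2 • f v := fun a v => by
    by_cases ha : a = 0
    · simp [ha]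
    · exact hf (Units.mk0 a ha) v
  obtain ⟨a, b, rfl⟩ := exists_eq_sq_sub_sq s
  rw [sub_smul, sub_smul, map_sub, hf', hf']

/-- An additive subgroup that is stable under multiplication by squares is a subspace. -/
theorem smul_mem_of_sq_smul_mem {V : Type*} [AddCommGroup V] [Module k V] (W : AddSubgroup V)
    (hW : ∀ (a : kˣ), ∀ v ∈ W, (a : k) ^ 2 • v ∈ W) (s : k) {v : V} (hv : v ∈ W) : s • v ∈ W := by
  have hW' : ∀ a : k, a ^ 2 • v ∈ W := fun a => by
    by_cases ha : a = 0
    · simp [ha]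
    · exact hW (Units.mk0 a ha) v hv
  obtain ⟨a, b, rfl⟩ := exists_eq_sq_sub_sq s
  rw [sub_smul]
  exact W.sub_mem (hW' a) (hW' b)

theorem exists_pow_ne_one (n : ℕ) (hn : 0 < n) (hk : n + 1 < Nat.card k) :
    ∃ a : kˣ, (a : k) ^ n ≠ 1 := by
  have := Fintype.ofFinite k
  classical
  by_contra! h
  -- Otherwise `k` consists of zero and the at most `n` roots of `X ^ n - 1`.
  have hsub : (Finset.univ : Finset k) ⊆ insert 0 (Polynomial.nthRoots n (1 : k)).toFinset := by
    intro a _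
    by_cases ha : a = 0
    · simp [ha]
    · refine Finset.mem_insert_of_mem ?_
      rw [Multiset.mem_toFinset, Polynomial.mem_nthRoots hn]
      exact h (Units.mk0 a ha)
  have h1 := Finset.card_le_card hsub
  have h2 := Finset.card_insert_le (0 : k) (Polynomial.nthRoots n (1 : k)).toFinset
  have h3 := Multiset.toFinset_card_le (Polynomial.nthRoots n (1 : k))
  have h4 := Polynomial.card_nthRoots n (1 : k)
  rw [Finset.card_univ, ← Nat.card_eq_fintype_card] at h1
  omega

end Field

/-! ### Vanishing of cohomology modulo scalars -/

section Main

variable {k : Type*} [Field k] {R : Type*} [CommRing R] [Algebra k R] (D : Subgroup kˣ)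

/-- The order of the torus divides `(q - 1)²`, hence is prime to `p`, and averaging applies. The
average stays in the subspace `I`. -/
theorem exists_torus_coboundary [Finite k] {S : AddSubgroup (Matrix (Fin 2) (Fin 2) R)}
    {I : Submodule k R}
    {c : GL2D D k → Matrix (Fin 2) (Fin 2) R}
    (hc : IsCocycleMod ((conj R).comp (GL2D D k).subtype) S c)
    (hI : ∀ g i j, c g i j ∈ I) :
    ∃ v : Matrix (Fin 2) (Fin 2) R, (∀ i j, v i j ∈ I) ∧
      ∀ a, c (torusD D a) - (conj R (torusD D a : GL (Fin 2) k) v - v) ∈ S := by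
  classical
  have := Fintype.ofFinite k
  have := Fintype.ofFinite (diagPairs D)
  obtain ⟨p, hp⟩ := CharP.exists k
  have hprime : p.Prime := (CharP.char_is_prime_or_zero k p).resolve_right
    (CharP.char_ne_zero_of_finite k p)
  have hcop : (Fintype.card (diagPairs D)).Coprime p := by
    have h1 : Fintype.card (diagPairs D) ∣ (Fintype.card k - 1) * (Fintype.card k - 1) := by
      have := Subgroup.card_subgroup_dvd_card (diagPairs D)
      rwa [Nat.card_eq_fintype_card, Nat.card_prod, Nat.card_eq_fintype_card,
        Fintype.card_units] at this
    refine Nat.Coprime.coprime_dvd_left h1 ?_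
    have h2 : p ∣ Fintype.card k := by
      rw [← CharP.cast_eq_zero_iff k p]
      exact Nat.cast_card_eq_zero k
    have h3 : (Fintype.card k - 1).Coprime p := by
      refine (Nat.Coprime.symm ?_)
      rw [Nat.Prime.coprime_iff_not_dvd hprime]
      intro h4
      have h5 := Nat.dvd_sub h2 h4
      have h6 : 0 < Fintype.card k := Fintype.card_pos
      rw [Nat.sub_sub_self h6] at h5
      exact hprime.one_lt.ne' (Nat.dvd_one.1 h5)
    exact Nat.Coprime.mul_left h3 h3
  obtain ⟨n, hn⟩ := (hc.comp (torusD D)).exists_coboundary (p := p)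
    (fun a => by rw [← Nat.cast_smul_eq_nsmul k, CharP.cast_eq_zero, zero_smul]) hcop
  refine ⟨_, fun i j => ?_, hn⟩
  rw [Matrix.neg_apply, Matrix.smul_apply, Matrix.sum_apply]
  exact I.neg_mem (I.smul_of_tower_mem _ (I.sum_mem fun _ _ => hI _ _ _))

variable {D}

theorem mem_map_scalar {X : AddSubgroup R} {A : Matrix (Fin 2) (Fin 2) R} :
    A ∈ X.map (Matrix.scalar (Fin 2) : R →+* _).toAddMonoidHom ↔
      A 0 0 ∈ X ∧ A 1 1 = A 0 0 ∧ A 0 1 = 0 ∧ A 1 0 = 0 := by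
  constructor
  · rintro ⟨x, hx, rfl⟩
    simpa using hx
  · rintro ⟨h0, h1, h2, h3⟩
    refine ⟨A 0 0, h0, ?_⟩
    ext i j
    fin_cases i <;> fin_cases j <;> simp [h1, h2, h3]

section Normalized

variable {X : AddSubgroup R} {c : GL2D D k → Matrix (Fin 2) (Fin 2) R}

/-- Once the cocycle is trivial on the torus, additivity of the unipotents and their scaling under
the torus leave one free parameter: the upper right entry at `1`. A diagonal coboundary can then
remove it. -/
theorem cocycle_upper_entries [Finite k]
    (hc : IsCocycleMod ((conj R).comp (GL2D D k).subtype)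
      (X.map (Matrix.scalar (Fin 2) : R →+* _).toAddMonoidHom) c)
    (hX : ∀ x ∈ X, x + x = 0) (htr : ∀ g, (c g).trace = 0)
    (ht : ∀ a, c (torusD D a) ∈ X.map (Matrix.scalar (Fin 2) : R →+* _).toAddMonoidHom)
    (h2 : ∃ a : kˣ, (a : k) ^ 2 ≠ 1) (h4 : (2 : k) = 0 ∨ ∃ a : kˣ, (a : k) ^ 4 ≠ 1) :
    ∀ x, c (upperUnipD D x) 1 0 = 0 ∧ c (upperUnipD D x) 0 0 ∈ X ∧
      c (upperUnipD D x) 0 1 = x • c (upperUnipD D 1) 0 1 := by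
  set α : k → R := fun x => c (upperUnipD D x) 0 0 with hα
  set β : k → R := fun x => c (upperUnipD D x) 0 1 with hβ
  set γ : k → R := fun x => c (upperUnipD D x) 1 0 with hγ
  have hδ : ∀ g, c g 1 1 = - c g 0 0 := fun g => by
    have := htr g
    rw [Matrix.trace_fin_two] at this
    exact eq_neg_of_add_eq_zero_right this
  have hadd : ∀ x y, γ (x + y) = γ x + γ y ∧
      β (x + y) = β x + β y - (2 * x) • α y - x ^ 2 • γ y ∧
      α (x + y) - α x - α y - x • γ y ∈ X := by
    intro x y
    have := hc.mul (upperUnipD D x) (upperUnipD D y)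
    rw [← upperUnipD_add, mem_map_scalar] at this
    simp only [MonoidHom.coe_comp, Subgroup.coe_subtype, Function.comp_apply, coe_upperUnipD,
      conj_upperUnip, Matrix.sub_apply, hδ, Matrix.of_apply, Matrix.cons_val', Matrix.cons_val_zero,
      Matrix.cons_val_one, Matrix.cons_val_fin_one] at this
    obtain ⟨e0, -, e2, e3⟩ := this
    refine ⟨?_, ?_, ?_⟩
    · linear_combination e3
    · simp only [hα, hβ, hγ]
      rw [sub_eq_zero, sub_eq_iff_eq_add'] at e2
      rw [e2]
      module
    · convert e0 using 1
      simp only [hα, hγ]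
      abel
  have htor : ∀ (a : kˣ) x, γ ((a : k) ^ 2 * x) = ((a : k) ^ 2)⁻¹ • γ x ∧
      β ((a : k) ^ 2 * x) = (a : k) ^ 2 • β x ∧ α ((a : k) ^ 2 * x) - α x ∈ X := by
    intro a x
    have := hc.mul_mul (ht (antiDiag D a)) (ht (antiDiag D a⁻¹)) (upperUnipD D x)
    rw [torusD_conj_upperUnipD, mem_map_scalar] at this
    simp only [MonoidHom.coe_comp, Subgroup.coe_subtype, Function.comp_apply, coe_torusD,
      coe_antiDiag, conj_diagHom, Matrix.sub_apply, hδ, Matrix.of_apply, Matrix.cons_val',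
      Matrix.cons_val_zero, Matrix.cons_val_one, Matrix.cons_val_fin_one, inv_inv] at this
    obtain ⟨e0, -, e2, e3⟩ := this
    refine ⟨?_, ?_, e0⟩
    · rw [← sub_eq_zero]
      convert e3 using 3
      simp [pow_two]
    · rw [← sub_eq_zero]
      convert e2 using 3
      simp [pow_two]
  have hγ0 : ∀ y, γ y = 0 := by
    have hγ00 : γ 0 = 0 := by simpa using (hadd 0 0).1
    have hβ00 : β 0 = 0 := by simpa using (hadd 0 0).2.1
    by_cases h20 : (2 : k) = 0
    · intro y
      by_cases hy : y = 0
      · rw [hy, hγ00]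
      -- In characteristic two `y + y = 0`, so the law for `β` reduces to `y ^ 2 • γ y = 0`.
      have e := (hadd y y).2.1
      have h1 : β y + β y = 0 := by rw [← two_smul k, h20, zero_smul]
      rw [← two_mul, h20, zero_mul, zero_smul, h1, hβ00, sub_zero, zero_sub, eq_comm,
        neg_eq_zero] at e
      exact (smul_eq_zero_iff_right (pow_ne_zero 2 hy)).1 e
    · obtain ⟨a, ha⟩ := h4.resolve_left h20
      -- Commutativity of the unipotents puts `y • γ 1 - γ y` in `X`, which is killed by the
      -- invertible number two. The torus then gives `(a ^ 4 - 1) • γ 1 = 0`.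
      have hsymm : ∀ y, γ y = y • γ 1 := by
        intro y
        have e := hX _ (X.sub_mem (hadd y 1).2.2 (hadd 1 y).2.2)
        rw [add_comm 1 y, ← two_smul k, smul_eq_zero_iff_right h20] at e
        rw [one_smul] at e
        linear_combination e
      have e := (htor a 1).1
      have ha0 : (a : k) ≠ 0 := a.ne_zero
      rw [mul_one, hsymm, eq_inv_smul_iff₀ (pow_ne_zero 2 ha0), smul_smul, ← sub_eq_zero] at e
      have e' : ((a : k) ^ 4 - 1) • γ 1 = 0 := by
        rw [← e]
        module
      have h1 := (smul_eq_zero_iff_right (sub_ne_zero.2 ha)).1 e'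
      intro y
      rw [hsymm, h1, smul_zero]
  have hαX : ∀ x, α x ∈ X := by
    obtain ⟨a, ha⟩ := h2
    intro x
    -- Modulo `X`, `α` is additive and invariant under scaling by `a ^ 2`.
    have key : ∀ y, α (((a : k) ^ 2 - 1) * y) ∈ X := by
      intro y
      have e1 := (hadd (((a : k) ^ 2 - 1) * y) y).2.2
      rw [hγ0, smul_zero, sub_zero] at e1
      have e2 := (htor a y).2.2
      rw [show ((a : k) ^ 2 - 1) * y + y = (a : k) ^ 2 * y by ring] at e1
      have := X.sub_mem e2 e1
      convert this using 1
      abel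
    have := key (((a : k) ^ 2 - 1)⁻¹ * x)
    rwa [mul_inv_cancel_left₀ (sub_ne_zero.2 ha)] at this
  have h2α : ∀ x y : k, (2 * x) • α y = 0 := fun x y => by
    rw [mul_comm, mul_smul, two_smul, hX _ (hαX y), smul_zero]
  let βh : k →+ R := AddMonoidHom.mk' β (fun x y => by
    rw [(hadd x y).2.1, h2α, hγ0, smul_zero, sub_zero, sub_zero])
  refine fun x => ⟨hγ0 x, hαX x, ?_⟩
  have := map_smul_of_map_sq_smul βh (fun a v => (htor a v).2.1) x 1
  rw [smul_eq_mul, mul_one] at this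
  exact this

theorem cocycle_weyl
    (hc : IsCocycleMod ((conj R).comp (GL2D D k).subtype)
      (X.map (Matrix.scalar (Fin 2) : R →+* _).toAddMonoidHom) c)
    (hX : ∀ x ∈ X, x + x = 0) (htr : ∀ g, (c g).trace = 0)
    (ht : ∀ a, c (torusD D a) ∈ X.map (Matrix.scalar (Fin 2) : R →+* _).toAddMonoidHom)
    (hu : ∀ x, c (upperUnipD D x) ∈ X.map (Matrix.scalar (Fin 2) : R →+* _).toAddMonoidHom)
    (h2 : ∃ a : kˣ, (a : k) ^ 2 ≠ 1) :
    c (weylD D) ∈ X.map (Matrix.scalar (Fin 2) : R →+* _).toAddMonoidHom := by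
  have hδ : c (weylD D) 1 1 = - c (weylD D) 0 0 := by
    have := htr (weylD D)
    rw [Matrix.trace_fin_two] at this
    exact eq_neg_of_add_eq_zero_right this
  obtain ⟨a, ha⟩ := h2
  -- The relation `t w t = w` makes `c w` minus its conjugate by `t` scalar, so each off-diagonal
  -- entry is killed by an invertible multiple of `a ^ 2 - 1`.
  have hoff : c (weylD D) 0 1 = 0 ∧ c (weylD D) 1 0 = 0 := by
    have := hc.mul_mul (ht (antiDiag D a)) (ht (antiDiag D a)) (weylD D)
    rw [torusD_mul_weylD, mem_map_scalar] at this
    simp only [MonoidHom.coe_comp, Subgroup.coe_subtype, Function.comp_apply, coe_torusD,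
      coe_antiDiag, conj_diagHom, Matrix.sub_apply, Matrix.of_apply, Matrix.cons_val',
      Matrix.cons_val_zero, Matrix.cons_val_one, Matrix.cons_val_fin_one, inv_inv] at this
    obtain ⟨-, -, e2, e3⟩ := this
    constructor
    · refine (smul_eq_zero_iff_right (sub_ne_zero.2 ha.symm)).1 ?_
      rw [← e2]
      module
    · refine (smul_eq_zero_iff_right (sub_ne_zero.2 ha)).1 ?_
      have : ((a : k) ^ 2 - 1) • c (weylD D) 1 0 = (a : k) ^ 2 • (c (weylD D) 1 0 -
          (((a⁻¹ : kˣ) : k) * ((a⁻¹ : kˣ) : k)) • c (weylD D) 1 0) := by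
        have ha1 : (a : k) ^ 2 * (((a⁻¹ : kˣ) : k) * ((a⁻¹ : kˣ) : k)) = 1 := by
          simp [pow_two]
          field_simp
        rw [smul_sub, smul_smul, sub_smul, ha1]
      rw [this, e3, smul_zero]
  -- Comparing the two sides of the braid relation leaves exactly the diagonal entry of `c w` modulo
  -- `X`.
  have h1 := hc.mul_mul (hu 1) (hu 1) (weylD D)
  rw [← weylD_braid, mul_assoc] at h1
  have h3 := hc.mul (weylD D) (upperUnipD D (-1) * weylD D)
  have h4 := hc.stable (weylD D) _ (hc.mul_left (hu (-1)) (weylD D))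
  have h5 := AddSubgroup.sub_mem _ (AddSubgroup.add_mem _ h3 h4) h1
  rw [mem_map_scalar] at h5
  simp only [MonoidHom.coe_comp, Subgroup.coe_subtype, Function.comp_apply, coe_upperUnipD,
    coe_weylD, conj_upperUnip, conj_weyl, Matrix.sub_apply, Matrix.add_apply, hδ, hoff,
    Matrix.of_apply, Matrix.cons_val', Matrix.cons_val_zero, Matrix.cons_val_one,
    Matrix.cons_val_fin_one, map_sub, smul_zero, smul_neg, one_smul, neg_smul] at h5
  obtain ⟨e0, e1, e2, e3⟩ := h5
  have hr : c (weylD D) 0 0 ∈ X := by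
    convert e0 using 1
    abel
  rw [mem_map_scalar]
  refine ⟨hr, ?_, hoff.1, hoff.2⟩
  rw [hδ]
  exact neg_eq_of_add_eq_zero_left (hX _ hr)

end Normalized

/-- The vanishing of the first cohomology of `GL₂ᴰ(k)` with values in trace-zero matrices modulo
scalars: every cocycle becomes a coboundary in the module of all matrices. -/
theorem exists_coboundary [Finite k] {X : AddSubgroup R} {I : Submodule k R}
    {c : GL2D D k → Matrix (Fin 2) (Fin 2) R}
    (hc : IsCocycleMod ((conj R).comp (GL2D D k).subtype)
      (X.map (Matrix.scalar (Fin 2) : R →+* _).toAddMonoidHom) c)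
    (hX : ∀ x ∈ X, x + x = 0) (htr : ∀ g, (c g).trace = 0) (hI : ∀ g i j, c g i j ∈ I)
    (h2 : ∃ a : kˣ, (a : k) ^ 2 ≠ 1) (h4 : (2 : k) = 0 ∨ ∃ a : kˣ, (a : k) ^ 4 ≠ 1) :
    ∃ v : Matrix (Fin 2) (Fin 2) R, (∀ i j, v i j ∈ I) ∧
      ∀ g : GL2D D k, c g - (conj R (g : GL (Fin 2) k) v - v) ∈
        X.map (Matrix.scalar (Fin 2) : R →+* _).toAddMonoidHom := by
  obtain ⟨v, hvI, hv⟩ := exists_torus_coboundary D hc hI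
  have hc1 := hc.sub_coboundary v
  have htr1 : ∀ g : GL2D D k, (c g - (conj R (g : GL (Fin 2) k) v - v)).trace = 0 := fun g => by
    rw [Matrix.trace_sub, Matrix.trace_sub, trace_conj, htr, sub_self, sub_zero]
  have hu1 := cocycle_upper_entries hc1 hX htr1 hv h2 h4
  set b := c (upperUnipD D 1) 0 1 - (conj R (upperUnipD D 1 : GL (Fin 2) k) v - v) 0 1 with hb
  have hbI : b ∈ I := I.sub_mem (hI _ _ _) (I.sub_mem (conj_mem _ hvI _ _) (hvI _ _))
  -- This matrix is fixed by the torus, so the first normalization survives, and its coboundary at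
  -- the unipotent `x` has upper right entry `x • b`. Its trace is `b`: this is where matrices of
  -- nonzero trace enter.
  have hc2 := hc1.sub_coboundary !![0, 0; 0, b]
  set c2 := fun g : GL2D D k => c g - (conj R (g : GL (Fin 2) k) v - v) -
    (conj R (g : GL (Fin 2) k) !![0, 0; 0, b] - !![0, 0; 0, b]) with hc2def
  have htr2 : ∀ g : GL2D D k, (c2 g).trace = 0 := fun g => by
    rw [Matrix.trace_sub, htr1, Matrix.trace_sub, trace_conj, sub_self, sub_zero]
  have ht2 : ∀ a, c2 (torusD D a) ∈ X.map (Matrix.scalar (Fin 2) : R →+* _).toAddMonoidHom := by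
    intro a
    have : c2 (torusD D a) = c (torusD D a) - (conj R (torusD D a : GL (Fin 2) k) v - v) := by
      simp only [hc2def]
      rw [coe_torusD, conj_diagHom _ !![0, 0; 0, b]]
      simp
    rw [this]
    exact hv a
  have hu2 : ∀ x, c2 (upperUnipD D x) ∈
      X.map (Matrix.scalar (Fin 2) : R →+* _).toAddMonoidHom := by
    intro x
    obtain ⟨e1, e2, e3⟩ := hu1 x
    have hδ : c2 (upperUnipD D x) 1 1 = - c2 (upperUnipD D x) 0 0 := by
      have := htr2 (upperUnipD D x)
      rw [Matrix.trace_fin_two] at this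
      exact eq_neg_of_add_eq_zero_right this
    have h00 : c2 (upperUnipD D x) 0 0 ∈ X := by
      convert e2 using 1
      simp only [hc2def]
      rw [coe_upperUnipD, Matrix.sub_apply, conj_upperUnip x !![0, 0; 0, b]]
      simp
    rw [mem_map_scalar]
    refine ⟨h00, ?_, ?_, ?_⟩
    · rw [hδ]
      exact neg_eq_of_add_eq_zero_left (hX _ h00)
    · simp only [hc2def]
      rw [Matrix.sub_apply]
      change _ = x • b at e3
      refine (congrArg (· - _) e3).trans ?_
      rw [coe_upperUnipD, conj_upperUnip x !![0, 0; 0, b]]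
      simp
    · simp only [hc2def]
      rw [Matrix.sub_apply]
      refine (congrArg (· - _) e1).trans ?_
      rw [coe_upperUnipD, conj_upperUnip x !![0, 0; 0, b]]
      simp
  have hw2 := cocycle_weyl hc2 hX htr2 ht2 hu2 h2
  have htop := GL2D_eq_top_of_generators D hc2.vanishing hu2 hw2 ht2
  refine ⟨v + !![0, 0; 0, b], fun i j => ?_, fun g => ?_⟩
  · refine I.add_mem (hvI i j) ?_
    fin_cases i <;> fin_cases j <;> simp [hbI]
  · have hg : g ∈ hc2.vanishing := htop ▸ Subgroup.mem_top g
    rw [hc2.mem_vanishing] at hg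
    convert hg using 1
    simp only [MonoidHom.coe_comp, Subgroup.coe_subtype, Function.comp_apply, map_add]
    abel

end Main

/-! ### Structure of conjugation-stable groups of trace-zero matrices -/

section Stable

variable {k : Type*} [Field k] {R : Type*} [CommRing R] [Algebra k R]

/-- An additive group of trace-zero matrices that is stable under conjugation by `GL₂ᴰ(k)`. -/
structure IsStable (D : Subgroup kˣ) (N : AddSubgroup (Matrix (Fin 2) (Fin 2) R)) : Prop where
  trace : ∀ A ∈ N, A.trace = 0
  conj : ∀ g : GL2D D k, ∀ A ∈ N, conj R (g : GL (Fin 2) k) A ∈ N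

namespace IsStable

variable {D : Subgroup kˣ} {N : AddSubgroup (Matrix (Fin 2) (Fin 2) R)}

theorem apply_one_one (hN : IsStable D N) {A : Matrix (Fin 2) (Fin 2) R} (hA : A ∈ N) :
    A 1 1 = - A 0 0 := by
  have := hN.trace A hA
  rw [Matrix.trace_fin_two] at this
  exact eq_neg_of_add_eq_zero_right this

/-- The diagonal parts of a stable group of matrices. -/
def diagPart (_ : IsStable D N) : AddSubgroup R where
  carrier := {x | !![x, 0; 0, -x] ∈ N}
  zero_mem' := by
    show !![(0 : R), 0; 0, -0] ∈ N
    convert N.zero_mem using 1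
    ext i j
    fin_cases i <;> fin_cases j <;> simp
  add_mem' {x y} hx hy := by
    show !![x + y, 0; 0, -(x + y)] ∈ N
    convert N.add_mem hx hy using 1
    ext i j
    fin_cases i <;> fin_cases j <;> simp [add_comm]
  neg_mem' {x} hx := by
    show !![-x, 0; 0, -(-x)] ∈ N
    convert N.neg_mem hx using 1
    ext i j
    fin_cases i <;> fin_cases j <;> simp

/-- The additive group of upper right entries of the strictly upper triangular matrices in a stable
group. -/
def offDiagPart (_ : IsStable D N) : AddSubgroup R where
  carrier := {x | !![0, x; 0, 0] ∈ N}
  zero_mem' := by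
    show !![(0 : R), 0; 0, 0] ∈ N
    convert N.zero_mem using 1
    ext i j
    fin_cases i <;> fin_cases j <;> simp
  add_mem' {x y} hx hy := by
    show !![0, x + y; 0, 0] ∈ N
    convert N.add_mem hx hy using 1
    ext i j
    fin_cases i <;> fin_cases j <;> simp
  neg_mem' {x} hx := by
    show !![0, -x; 0, 0] ∈ N
    convert N.neg_mem hx using 1
    ext i j
    fin_cases i <;> fin_cases j <;> simp

theorem mem_diagPart (hN : IsStable D N) {x : R} : x ∈ hN.diagPart ↔ !![x, 0; 0, -x] ∈ N := Iff.rfl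

theorem mem_offDiagPart (hN : IsStable D N) {x : R} :
    x ∈ hN.offDiagPart ↔ !![0, x; 0, 0] ∈ N := Iff.rfl

theorem smul_mem_offDiagPart [Finite k] (hN : IsStable D N) (s : k) {x : R}
    (hx : x ∈ hN.offDiagPart) : s • x ∈ hN.offDiagPart := by
  refine smul_mem_of_sq_smul_mem _ (fun a v hv => ?_) s hx
  have := hN.conj (torusD D (antiDiag D a)) _ hv
  rw [coe_torusD, conj_diagHom] at this
  simpa [mem_offDiagPart, pow_two] using this

/-- The off-diagonal part as a `k`-subspace. -/
def offDiag [Finite k] (hN : IsStable D N) : Submodule k R where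
  __ := hN.offDiagPart
  smul_mem' s _ hx := hN.smul_mem_offDiagPart s hx

variable [Finite k]

theorem mem_offDiag (hN : IsStable D N) {x : R} : x ∈ hN.offDiag ↔ !![0, x; 0, 0] ∈ N := Iff.rfl

theorem mem_offDiag_iff_lower (hN : IsStable D N) {x : R} :
    x ∈ hN.offDiag ↔ !![0, 0; x, 0] ∈ N := by
  rw [← neg_mem_iff, mem_offDiag]
  constructor <;> intro h
  · have := hN.conj (weylD D) _ h
    rw [coe_weylD, conj_weyl] at this
    simpa using this
  · have := hN.conj (weylD D) _ h
    rw [coe_weylD, conj_weyl] at this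
    simpa using this

/-- Conjugating a lower nilpotent matrix by `[1, 1; 0, 1]` produces a diagonal part; subtracting its
nilpotent parts isolates it. -/
theorem offDiag_le_diagPart (hN : IsStable D N) {x : R} (hx : x ∈ hN.offDiag) :
    x ∈ hN.diagPart := by
  have h1 := hN.mem_offDiag_iff_lower.1 hx
  have h2 := hN.conj (upperUnipD D 1) _ h1
  rw [coe_upperUnipD, conj_upperUnip] at h2
  have h3 := N.sub_mem (N.add_mem h2 hx) h1
  rw [mem_diagPart]
  convert h3 using 1
  ext i j
  fin_cases i <;> fin_cases j <;> simp

theorem entries_mem (hN : IsStable D N) (h2 : ∃ a : kˣ, (a : k) ^ 2 ≠ 1)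
    {A : Matrix (Fin 2) (Fin 2) R} (hA : A ∈ N) :
    A 1 0 ∈ hN.offDiag ∧ A 0 0 + A 0 0 ∈ hN.offDiag := by
  obtain ⟨a, ha⟩ := h2
  have h11 := hN.apply_one_one hA
  -- Conjugating by the unipotent `t` and subtracting `A` removes the lower left entry; subtracting
  -- the torus conjugate then removes the diagonal. What remains is upper nilpotent.
  have key : ∀ t : k, t • (A 0 0 + A 0 0) + t ^ 2 • A 1 0 ∈ hN.offDiag := by
    intro t
    have h1 := hN.conj (upperUnipD D t) _ hA
    rw [coe_upperUnipD, conj_upperUnip] at h1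
    have h3 := N.sub_mem h1 hA
    have h4 := hN.conj (torusD D (antiDiag D a)) _ h3
    rw [coe_torusD, conj_diagHom] at h4
    have h5 := N.sub_mem h3 h4
    have h6 : ((a : k) ^ 2 - 1) • (t • (A 0 0 + A 0 0) + t ^ 2 • A 1 0) ∈ hN.offDiag := by
      rw [mem_offDiag]
      convert h5 using 1
      ext i j
      fin_cases i <;> fin_cases j <;> simp [h11]
      module
    have h7 := hN.offDiag.smul_mem ((a : k) ^ 2 - 1)⁻¹ h6
    rwa [smul_smul, inv_mul_cancel₀ (sub_ne_zero.2 ha), one_smul] at h7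
  have ha0 : (a : k) ≠ 0 := a.ne_zero
  have ha1 : (a : k) - 1 ≠ 0 := by
    intro h
    rw [sub_eq_zero] at h
    exact ha (by rw [h, one_pow])
  have h10 : A 1 0 ∈ hN.offDiag := by
    -- The expression at `t = a` minus `a` times the one at `t = 1` cancels the linear term.
    have h3 := hN.offDiag.smul_mem ((a : k) * (a - 1))⁻¹
      (hN.offDiag.sub_mem (key a) (hN.offDiag.smul_mem (a : k) (key 1)))
    convert h3 using 1
    have : (a : k) • (A 0 0 + A 0 0) + (a : k) ^ 2 • A 1 0 -
        (a : k) • ((1 : k) • (A 0 0 + A 0 0) + (1 : k) ^ 2 • A 1 0) =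
        ((a : k) * (a - 1)) • A 1 0 := by module
    rw [this, smul_smul, inv_mul_cancel₀ (mul_ne_zero ha0 ha1), one_smul]
  refine ⟨h10, ?_⟩
  have := hN.offDiag.sub_mem (key 1) h10
  simpa using this

/-- A stable group of matrices is determined by its diagonal and off-diagonal parts. -/
theorem mem_iff (hN : IsStable D N) (h2 : ∃ a : kˣ, (a : k) ^ 2 ≠ 1)
    {A : Matrix (Fin 2) (Fin 2) R} :
    A ∈ N ↔ A 0 0 ∈ hN.diagPart ∧ A 0 1 ∈ hN.offDiag ∧ A 1 0 ∈ hN.offDiag ∧ A 1 1 = - A 0 0 := by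
  constructor
  · intro hA
    have h11 := hN.apply_one_one hA
    have h10 := (hN.entries_mem h2 hA).1
    have h01 : A 0 1 ∈ hN.offDiag := by
      have h3 := hN.conj (weylD D) _ hA
      have h4 := (hN.entries_mem h2 h3).1
      rw [coe_weylD, conj_weyl] at h4
      simpa using h4
    refine ⟨?_, h01, h10, h11⟩
    have h3 := N.sub_mem (N.sub_mem hA h01) (hN.mem_offDiag_iff_lower.1 h10)
    rw [mem_diagPart]
    convert h3 using 1
    ext i j
    fin_cases i <;> fin_cases j <;> simp [h11]
  · rintro ⟨h00, h01, h10, h11⟩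
    have h3 := N.add_mem (N.add_mem h00 h01) (hN.mem_offDiag_iff_lower.1 h10)
    convert h3 using 1
    ext i j
    fin_cases i <;> fin_cases j <;> simp [h11]

theorem add_self_mem_offDiag (hN : IsStable D N) (h2 : ∃ a : kˣ, (a : k) ^ 2 ≠ 1) {x : R}
    (hx : x ∈ hN.diagPart) : x + x ∈ hN.offDiag := by
  simpa using (hN.entries_mem h2 hx).2

theorem diagPart_eq_offDiagPart (hN : IsStable D N) (h2 : ∃ a : kˣ, (a : k) ^ 2 ≠ 1)
    (h20 : (2 : k) ≠ 0) : hN.diagPart = hN.offDiag.toAddSubgroup := by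
  ext x
  refine ⟨fun hx => ?_, fun hx => hN.offDiag_le_diagPart hx⟩
  have h3 := hN.offDiag.smul_mem (2 : k)⁻¹ (hN.add_self_mem_offDiag h2 hx)
  rwa [← two_smul k, smul_smul, inv_mul_cancel₀ h20, one_smul] at h3

end IsStable

end Stable

/-! ### Subgroups of `GL₂ᴰ(T)` over a square-zero extension -/

section SquareZero

variable {k : Type*} [Field k] {T : Type*} [CommRing T] [Algebra k T] {π : T →ₐ[k] k}

/-- The embedding `GL₂(k) → GL₂(T)`. -/
abbrev constGL (T : Type*) [CommRing T] [Algebra k T] : GL (Fin 2) k →* GL (Fin 2) T :=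
  Matrix.GeneralLinearGroup.map (algebraMap k T)

/-- The reduction `GL₂(T) → GL₂(k)`. -/
abbrev redGL (π : T →ₐ[k] k) : GL (Fin 2) T →* GL (Fin 2) k :=
  Matrix.GeneralLinearGroup.map (π : T →+* k)

/-- The matrices that reduce to zero. -/
def MatKer (π : T →ₐ[k] k) : Submodule k (Matrix (Fin 2) (Fin 2) T) where
  carrier := {A | ∀ i j, π (A i j) = 0}
  zero_mem' := fun _ _ => map_zero π
  add_mem' := fun hA hB i j => by rw [Matrix.add_apply, map_add, hA, hB, add_zero]
  smul_mem' := fun c A hA i j => by rw [Matrix.smul_apply, map_smul, hA, smul_zero]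

theorem mem_matKer {A : Matrix (Fin 2) (Fin 2) T} :
    A ∈ MatKer π ↔ ∀ i j, π (A i j) = 0 := Iff.rfl

theorem mem_matKer_iff_map {A : Matrix (Fin 2) (Fin 2) T} : A ∈ MatKer π ↔ A.map π = 0 := by
  rw [mem_matKer, ← Matrix.ext_iff]
  rfl

theorem map_mul_matrix (A B : Matrix (Fin 2) (Fin 2) T) : (A * B).map π = A.map π * B.map π :=
  Matrix.map_mul (f := (π : T →+* k))

theorem map_one_matrix : (1 : Matrix (Fin 2) (Fin 2) T).map π = 1 :=
  Matrix.map_one _ (map_zero π) (map_one π)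

theorem map_sub_matrix (A B : Matrix (Fin 2) (Fin 2) T) : (A - B).map π = A.map π - B.map π := by
  ext
  simp

theorem map_add_matrix (A B : Matrix (Fin 2) (Fin 2) T) : (A + B).map π = A.map π + B.map π := by
  ext
  simp

theorem coe_redGL (g : GL (Fin 2) T) :
    (redGL π g : Matrix (Fin 2) (Fin 2) k) = (g : Matrix (Fin 2) (Fin 2) T).map π := rfl

theorem coe_constGL (g : GL (Fin 2) k) :
    (constGL T g : Matrix (Fin 2) (Fin 2) T) =
      (g : Matrix (Fin 2) (Fin 2) k).map (algebraMap k T) := rfl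

theorem redGL_constGL (g : GL (Fin 2) k) : redGL π (constGL T g) = g := by
  ext i j
  simp

theorem coe_constGL_map (g : GL (Fin 2) k) :
    (constGL T g : Matrix (Fin 2) (Fin 2) T).map π = g := by
  rw [← coe_redGL, redGL_constGL]

theorem mul_mem_matKer {A B : Matrix (Fin 2) (Fin 2) T} (hA : A ∈ MatKer π) : A * B ∈ MatKer π := by
  rw [mem_matKer_iff_map] at *
  rw [map_mul_matrix, hA, zero_mul]

theorem mul_mem_matKer' {A B : Matrix (Fin 2) (Fin 2) T} (hB : B ∈ MatKer π) : A * B ∈ MatKer π := by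
  rw [mem_matKer_iff_map] at *
  rw [map_mul_matrix, hB, mul_zero]

theorem sub_mem_matKer {A B : Matrix (Fin 2) (Fin 2) T} :
    A - B ∈ MatKer π ↔ A.map π = B.map π := by
  rw [mem_matKer_iff_map, map_sub_matrix, sub_eq_zero]

theorem conj_mem_matKer (g : GL (Fin 2) k) {A : Matrix (Fin 2) (Fin 2) T} (hA : A ∈ MatKer π) :
    conj T g A ∈ MatKer π := by
  rw [conj_apply]
  exact mul_mem_matKer (mul_mem_matKer' hA)

theorem constGL_mul_eq (g : GL (Fin 2) k) (A : Matrix (Fin 2) (Fin 2) T) :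
    (constGL T g : Matrix (Fin 2) (Fin 2) T) * A = conj T g A * constGL T g := by
  rw [conj_apply, Units.inv_mul_cancel_right]

theorem mem_GL2D {D : Subgroup kˣ} {g : GL (Fin 2) T} :
    g ∈ GL2D D T ↔ ∃ d ∈ D, algebraMap k T d = (g : Matrix (Fin 2) (Fin 2) T).det := by
  rw [GL2D, Subgroup.mem_comap, Subgroup.mem_map]
  constructor
  · rintro ⟨d, hd, h⟩
    exact ⟨d, hd, congrArg Units.val h⟩
  · rintro ⟨d, hd, h⟩
    exact ⟨d, hd, Units.ext h⟩

theorem constGL_mem_GL2D {D : Subgroup kˣ} {g : GL (Fin 2) k} (hg : g ∈ GL2D D k) :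
    constGL T g ∈ GL2D D T := by
  rw [mem_GL2D]
  refine ⟨_, mem_GL2D_self.1 hg, ?_⟩
  rw [coe_constGL, ← RingHom.mapMatrix_apply, ← RingHom.map_det]
  rfl

theorem redGL_mem_GL2D {D : Subgroup kˣ} {g : GL (Fin 2) T} (hg : g ∈ GL2D D T) :
    redGL π g ∈ GL2D D k := by
  obtain ⟨d, hd, h⟩ := mem_GL2D.1 hg
  rw [mem_GL2D_self]
  convert hd
  ext
  have h1 := congrArg π h
  rw [AlgHom.commutes] at h1
  have h2 : (redGL π g : Matrix (Fin 2) (Fin 2) k).det = π (g : Matrix (Fin 2) (Fin 2) T).det :=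
    (RingHom.map_det (π : T →+* k) _).symm
  rw [Matrix.GeneralLinearGroup.val_det_apply, h2, ← h1]
  rfl

/-- The kernel of `π` has square zero. -/
def SquareZero (π : T →ₐ[k] k) : Prop := ∀ x y, π x = 0 → π y = 0 → x * y = 0

namespace SquareZero

variable (hπ : SquareZero π)

include hπ

theorem mul_eq_zero {A B : Matrix (Fin 2) (Fin 2) T} (hA : A ∈ MatKer π) (hB : B ∈ MatKer π) :
    A * B = 0 := by
  ext i j
  rw [Matrix.mul_apply, Matrix.zero_apply]
  exact Finset.sum_eq_zero fun l _ => hπ _ _ (hA _ _) (hB _ _)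

theorem mul_congr_left {A B C : Matrix (Fin 2) (Fin 2) T} (h : A.map π = B.map π)
    (hC : C ∈ MatKer π) : A * C = B * C := by
  rw [← sub_eq_zero, ← sub_mul]
  exact hπ.mul_eq_zero (sub_mem_matKer.2 h) hC

theorem one_add_mul {A B : Matrix (Fin 2) (Fin 2) T} (hA : A ∈ MatKer π) (hB : B ∈ MatKer π) :
    (1 + A) * (1 + B) = 1 + (A + B) := by
  rw [add_mul, mul_add, mul_add, hπ.mul_eq_zero hA hB]
  simp
  abel

/-- The homomorphism `A ↦ 1 + A` into `GL₂(T)`, for `A` reducing to zero. -/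
def oneAddHom : Multiplicative (MatKer π) →* GL (Fin 2) T where
  toFun A := ⟨1 + A.toAdd, 1 + -A.toAdd,
    by rw [hπ.one_add_mul A.toAdd.2 (neg_mem A.toAdd.2)]; simp,
    by rw [hπ.one_add_mul (neg_mem A.toAdd.2) A.toAdd.2]; simp⟩
  map_one' := by
    refine Units.ext ?_
    simp
  map_mul' A B := by
    refine Units.ext ?_
    simp only [Units.val_mul]
    rw [hπ.one_add_mul A.toAdd.2 B.toAdd.2]
    simp

theorem exists_one_add {A : Matrix (Fin 2) (Fin 2) T} (hA : A ∈ MatKer π) :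
    ∃ g : GL (Fin 2) T, (g : Matrix (Fin 2) (Fin 2) T) = 1 + A ∧
      ((g⁻¹ : GL (Fin 2) T) : Matrix (Fin 2) (Fin 2) T) = 1 + -A :=
  ⟨hπ.oneAddHom (Multiplicative.ofAdd ⟨A, hA⟩), rfl, rfl⟩

theorem det_one_add {A : Matrix (Fin 2) (Fin 2) T} (hA : A ∈ MatKer π) :
    (1 + A).det = 1 + A.trace := by
  rw [Matrix.det_fin_two, Matrix.trace_fin_two]
  have h1 := hπ _ _ (hA 0 0) (hA 1 1)
  have h2 := hπ _ _ (hA 0 1) (hA 1 0)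
  simp
  linear_combination h1 - h2

/-- The determinant `1 + tr A` is a constant from `k` that reduces to `1`, hence equals `1`. -/
theorem trace_eq_zero_of_one_add_mem {D : Subgroup kˣ} {A : Matrix (Fin 2) (Fin 2) T}
    (hA : A ∈ MatKer π) {g : GL (Fin 2) T} (hg : (g : Matrix (Fin 2) (Fin 2) T) = 1 + A)
    (hgD : g ∈ GL2D D T) : A.trace = 0 := by
  obtain ⟨d, -, hd⟩ := mem_GL2D.1 hgD
  rw [hg, hπ.det_one_add hA] at hd
  have htr : π A.trace = 0 := by
    rw [Matrix.trace_fin_two, map_add, hA, hA, add_zero]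
  have h1 := congrArg π hd
  rw [AlgHom.commutes, map_add, map_one, htr, add_zero] at h1
  have h2 : (d : k) = 1 := h1
  rw [h2, map_one] at hd
  exact (left_eq_add.1 hd)

theorem one_add_mem_GL2D {D : Subgroup kˣ} {A : Matrix (Fin 2) (Fin 2) T}
    (hA : A ∈ MatKer π) {g : GL (Fin 2) T} (hg : (g : Matrix (Fin 2) (Fin 2) T) = 1 + A)
    (htr : A.trace = 0) : g ∈ GL2D D T := by
  rw [mem_GL2D]
  refine ⟨1, D.one_mem, ?_⟩
  rw [hg, hπ.det_one_add hA, htr, add_zero]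
  simp

/-- The matrices `A`, reducing to zero, with `1 + A` in a given subgroup. -/
def kernel (G : Subgroup (GL (Fin 2) T)) : AddSubgroup (Matrix (Fin 2) (Fin 2) T) where
  carrier := {A | A ∈ MatKer π ∧ ∃ g ∈ G, (g : Matrix (Fin 2) (Fin 2) T) = 1 + A}
  zero_mem' := ⟨zero_mem _, 1, G.one_mem, by simp⟩
  add_mem' := by
    rintro A B ⟨hA, g, hg, hgA⟩ ⟨hB, h, hh, hhB⟩
    refine ⟨add_mem hA hB, g * h, G.mul_mem hg hh, ?_⟩
    rw [Units.val_mul, hgA, hhB, hπ.one_add_mul hA hB]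
  neg_mem' := by
    rintro A ⟨hA, g, hg, hgA⟩
    refine ⟨neg_mem hA, g⁻¹, G.inv_mem hg, ?_⟩
    obtain ⟨h, h1, h2⟩ := hπ.exists_one_add hA
    have : g = h := Units.ext (hgA.trans h1.symm)
    rw [this, h2]

/-- A lift of `g` to `G` differs from the constant matrix `g` by a matrix over the square-zero
ideal, which annihilates `A`; both therefore conjugate `A` in the same way. -/
theorem isStable_kernel {D : Subgroup kˣ} {G : Subgroup (GL (Fin 2) T)} (hG : G ≤ GL2D D T)
    (hGD : GL2D D k ≤ G.map (redGL π)) : IsStable D (hπ.kernel G) where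
  trace := by
    rintro A ⟨hA, g, hg, hgA⟩
    exact hπ.trace_eq_zero_of_one_add_mem hA hgA (hG hg)
  conj := by
    rintro g A ⟨hA, h, hh, hhA⟩
    obtain ⟨g', hg', hgg'⟩ := hGD g.2
    refine ⟨conj_mem_matKer _ hA, g' * h * g'⁻¹, G.mul_mem (G.mul_mem hg' hh) (G.inv_mem hg'), ?_⟩
    rw [← Units.mul_left_inj g', ← Units.val_mul, inv_mul_cancel_right, Units.val_mul, hhA,
      mul_add, add_mul, mul_one, one_mul]
    congr 1
    have h1 : (g' : Matrix (Fin 2) (Fin 2) T).map π = (constGL T (g : GL (Fin 2) k) :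
        Matrix (Fin 2) (Fin 2) T).map π := by
      rw [coe_constGL_map, ← hgg', coe_redGL]
    rw [hπ.mul_congr_left h1 hA, constGL_mul_eq]
    have h2 : (g' : Matrix (Fin 2) (Fin 2) T) - constGL T (g : GL (Fin 2) k) ∈ MatKer π :=
      sub_mem_matKer.2 h1
    have h3 := hπ.mul_eq_zero (conj_mem_matKer (g : GL (Fin 2) k) hA) h2
    rw [mul_sub, sub_eq_zero] at h3
    exact h3.symm

theorem offDiag_le_ker [Finite k] {D : Subgroup kˣ} {G : Subgroup (GL (Fin 2) T)}
    (hN : IsStable D (hπ.kernel G)) {x : T} (hx : x ∈ hN.offDiag) : π x = 0 := by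
  simpa using (hN.mem_offDiag.1 hx).1 0 1

theorem diagPart_le_ker {D : Subgroup kˣ} {G : Subgroup (GL (Fin 2) T)}
    (hN : IsStable D (hπ.kernel G)) {x : T} (hx : x ∈ hN.diagPart) : π x = 0 := by
  simpa using (hN.mem_diagPart.1 hx).1 0 0

/-- A subspace of the kernel of `π` is an ideal. -/
def toIdeal (W : Submodule k T) (hW : ∀ x ∈ W, π x = 0) : Ideal T where
  __ := W
  smul_mem' t x hx := by
    have h := hπ (t - algebraMap k T (π t)) x (by simp) (hW x hx)
    rw [sub_mul, sub_eq_zero] at h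
    show t * x ∈ W
    rw [h, ← Algebra.smul_def]
    exact W.smul_mem _ hx

/-- The cocycle measures how far a set-theoretic section of the reduction is from the constant
embedding. -/
theorem exists_cocycle {D : Subgroup kˣ} {G : Subgroup (GL (Fin 2) T)} (hG : G ≤ GL2D D T)
    (hGD : GL2D D k ≤ G.map (redGL π)) :
    ∃ c : GL2D D k → Matrix (Fin 2) (Fin 2) T, (∀ g, c g ∈ MatKer π) ∧ (∀ g, (c g).trace = 0) ∧
      (∀ g : GL2D D k, ∃ g' ∈ G, (g' : Matrix (Fin 2) (Fin 2) T) =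
        (1 + c g) * constGL T (g : GL (Fin 2) k)) ∧
      IsCocycleMod ((conj T).comp (GL2D D k).subtype) (hπ.kernel G) c := by
  choose s hs hsr using fun g : GL2D D k => hGD g.2
  set c : GL2D D k → Matrix (Fin 2) (Fin 2) T := fun g =>
    (s g * (constGL T (g : GL (Fin 2) k))⁻¹ : GL (Fin 2) T) - 1 with hcdef
  have hc : ∀ g : GL2D D k, (s g : Matrix (Fin 2) (Fin 2) T) =
      (1 + c g) * constGL T (g : GL (Fin 2) k) := fun g => by
    rw [hcdef, add_sub_cancel, ← Units.val_mul, inv_mul_cancel_right]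
  have hcK : ∀ g, c g ∈ MatKer π := fun g => by
    rw [hcdef, sub_mem_matKer, ← coe_redGL, map_mul, map_inv, redGL_constGL, hsr, mul_inv_cancel,
      map_one_matrix]
    rfl
  refine ⟨c, hcK, fun g => ?_, fun g => ⟨s g, hs g, hc g⟩, ?_⟩
  · refine hπ.trace_eq_zero_of_one_add_mem (hcK g) (add_sub_cancel _ _).symm
      ((GL2D D T).mul_mem (hG (hs g)) ((GL2D D T).inv_mem (constGL_mem_GL2D g.2)))
  · refine ⟨fun g A hA => (hπ.isStable_kernel hG hGD).conj g A hA, fun g h => ?_⟩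
    have hK : c (g * h) - c g - conj T (g : GL (Fin 2) k) (c h) ∈ MatKer π :=
      sub_mem (sub_mem (hcK _) (hcK _)) (conj_mem_matKer _ (hcK _))
    refine ⟨hK, s (g * h) * (s g * s h)⁻¹,
      G.mul_mem (hs _) (G.inv_mem (G.mul_mem (hs _) (hs _))), ?_⟩
    rw [← Units.mul_left_inj (s g * s h), ← Units.val_mul, inv_mul_cancel_right, hc (g * h),
      Units.val_mul, hc g, hc h]
    have e1 : (1 + c g) * (constGL T (g : GL (Fin 2) k) : Matrix (Fin 2) (Fin 2) T) *
        ((1 + c h) * constGL T (h : GL (Fin 2) k)) =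
        (1 + (c g + conj T (g : GL (Fin 2) k) (c h))) * constGL T ((g * h : GL2D D k) :
          GL (Fin 2) k) := by
      rw [Subgroup.coe_mul, map_mul, Units.val_mul, ← hπ.one_add_mul (hcK g) (conj_mem_matKer _ (hcK h))]
      simp only [mul_assoc]
      congr 1
      simp only [← mul_assoc]
      congr 1
      rw [mul_add, add_mul, mul_one, one_mul, constGL_mul_eq]
    rw [e1, ← mul_assoc]
    congr 1
    rw [MonoidHom.comp_apply, Subgroup.coe_subtype,
      hπ.one_add_mul hK (add_mem (hcK g) (conj_mem_matKer _ (hcK h)))]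
    abel

theorem exists_conj_le [Finite k] {D : Subgroup kˣ} {G : Subgroup (GL (Fin 2) T)}
    (hG : G ≤ GL2D D T) (hGD : GL2D D k ≤ G.map (redGL π))
    (h2 : ∃ a : kˣ, (a : k) ^ 2 ≠ 1) (h4 : (2 : k) = 0 ∨ ∃ a : kˣ, (a : k) ^ 4 ≠ 1) :
    ∃ P : GL (Fin 2) T, redGL π P = 1 ∧ ∀ g ∈ GL2D D k, P⁻¹ * constGL T g * P ∈ G := by
  obtain ⟨c, hcK, hctr, hcG, hc⟩ := hπ.exists_cocycle hG hGD
  have hN := hπ.isStable_kernel hG hGD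
  -- Modulo `W` the kernel of `G` becomes a group of scalar matrices killed by two, the situation of
  -- `exists_coboundary`.
  set W : Ideal T := hπ.toIdeal hN.offDiag (fun x hx => hπ.offDiag_le_ker hN hx) with hW
  have hWmem : ∀ x, x ∈ W ↔ x ∈ hN.offDiag := fun x => Iff.rfl
  set f : T →ₐ[k] T ⧸ W := Ideal.Quotient.mkₐ k W with hf
  have hf0 : ∀ x, f x = 0 ↔ x ∈ hN.offDiag := fun x => Ideal.Quotient.eq_zero_iff_mem
  have hfconj : ∀ (g : GL (Fin 2) k) (A : Matrix (Fin 2) (Fin 2) T),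
      (conj T g A).map f = conj (T ⧸ W) g (A.map f) := fun g A => by
    ext i j
    simp only [Matrix.map_apply, conj_entries, map_sum, map_smul]
  have hfsub : ∀ A B : Matrix (Fin 2) (Fin 2) T, (A - B).map f = A.map f - B.map f := fun A B => by
    ext
    simp
  set X : AddSubgroup (T ⧸ W) := hN.diagPart.map (f : T →+* T ⧸ W).toAddMonoidHom with hXdef
  have hX : ∀ x ∈ X, x + x = 0 := by
    rintro _ ⟨x, hx, rfl⟩
    have := (hf0 _).2 (hN.add_self_mem_offDiag h2 hx)
    rw [map_add] at this
    exact this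
  have hSmem : ∀ A : Matrix (Fin 2) (Fin 2) T, A ∈ hπ.kernel G → A.map f ∈
      X.map (Matrix.scalar (Fin 2) : T ⧸ W →+* _).toAddMonoidHom := by
    intro A hA
    obtain ⟨e0, e1, e2, e3⟩ := (hN.mem_iff h2).1 hA
    rw [mem_map_scalar]
    have hX0 : f (A 0 0) ∈ X := ⟨_, e0, rfl⟩
    refine ⟨hX0, ?_, (hf0 _).2 e1, (hf0 _).2 e2⟩
    rw [Matrix.map_apply, e3, map_neg]
    exact neg_eq_of_add_eq_zero_left (hX _ hX0)
  have hc' : IsCocycleMod ((conj (T ⧸ W)).comp (GL2D D k).subtype)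
      (X.map (Matrix.scalar (Fin 2) : T ⧸ W →+* _).toAddMonoidHom) (fun g => (c g).map f) := by
    refine ⟨?_, fun g h => ?_⟩
    · rintro g _ ⟨x, hx, rfl⟩
      refine ⟨x, hx, ?_⟩
      exact (conj_scalar (g : GL (Fin 2) k) x).symm
    · have := hSmem _ (hc.mul g h)
      rwa [hfsub, hfsub, MonoidHom.comp_apply, hfconj] at this
  -- With `I` the image of `ker π`, the bounding matrix lifts to one reducing to zero, so that `1 +
  -- v` is invertible and reduces to `1`.
  obtain ⟨v', hv'I, hv'⟩ := exists_coboundary (I := (LinearMap.ker π.toLinearMap).map f.toLinearMap)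
    hc' hX
    (fun g => by
      have := congrArg f (hctr g)
      rw [Matrix.trace_fin_two] at this ⊢
      simpa using this)
    (fun g i j => ⟨c g i j, hcK g i j, rfl⟩) h2 h4
  choose v hvK hvf using hv'I
  have hvmap : (Matrix.of v).map f = v' := Matrix.ext hvf
  have hvK' : Matrix.of v ∈ MatKer π := hvK
  have hmem : ∀ g : GL2D D k, c g - (conj T (g : GL (Fin 2) k) (Matrix.of v) - Matrix.of v) ∈
      hπ.kernel G := by
    intro g
    have h1 := hv' g
    rw [← hvmap, ← hfconj, ← hfsub, ← hfsub, mem_map_scalar] at h1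
    set A := c g - (conj T (g : GL (Fin 2) k) (Matrix.of v) - Matrix.of v) with hA
    have htr : A.trace = 0 := by
      rw [hA, Matrix.trace_sub, Matrix.trace_sub, trace_conj, hctr, sub_self, sub_zero]
    obtain ⟨⟨x, hx, e0⟩, e1, e2, e3⟩ := h1
    rw [hN.mem_iff h2]
    refine ⟨?_, (hf0 _).1 e2, (hf0 _).1 e3, ?_⟩
    · have h3 : A 0 0 - x ∈ hN.offDiag := by
        rw [← hf0, map_sub, sub_eq_zero]
        exact e0.symm
      have := hN.diagPart.add_mem (hN.offDiag_le_diagPart h3) hx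
      rwa [sub_add_cancel] at this
    · rw [Matrix.trace_fin_two] at htr
      exact eq_neg_of_add_eq_zero_right htr
  obtain ⟨P, hP, hPinv⟩ := hπ.exists_one_add hvK'
  refine ⟨P, ?_, fun g hg => ?_⟩
  · refine Units.ext ?_
    rw [coe_redGL, hP, map_add_matrix, mem_matKer_iff_map.1 hvK', map_one_matrix]
    simp
  · obtain ⟨hK, n, hnG, hn⟩ := hmem ⟨g, hg⟩
    obtain ⟨s, hsG, hs⟩ := hcG ⟨g, hg⟩
    -- Since `P⁻¹ g P = (1 - v + g v g⁻¹) g`, the correction `n` turns it into the lift `s = (1 + c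
    -- g) g`.
    suffices h : n * (P⁻¹ * constGL T g * P) = s by
      rw [← inv_mul_eq_iff_eq_mul.2 h.symm]
      exact G.mul_mem (G.inv_mem hnG) hsG
    refine Units.ext ?_
    simp only at hK hn hs
    rw [Units.val_mul, Units.val_mul, Units.val_mul, hn, hP, hPinv, hs, mul_assoc _ _ (1 + of v),
      mul_add, mul_one, constGL_mul_eq]
    have : (constGL T g : Matrix (Fin 2) (Fin 2) T) + conj T g (of v) * constGL T g =
      (1 + conj T g (of v)) * constGL T g := by rw [add_mul, one_mul]
    rw [this, ← mul_assoc, ← mul_assoc, hπ.one_add_mul hK (neg_mem hvK'),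
      hπ.one_add_mul (add_mem hK (neg_mem hvK')) (conj_mem_matKer _ hvK')]
    congr 2
    abel

end SquareZero

end SquareZero

/-! ### Splitting into a semidirect product -/

section Semidirect

variable {k : Type*} [Field k] {T : Type*} [CommRing T] [Algebra k T] {π : T →ₐ[k] k}
  {D : Subgroup kˣ} {G : Subgroup (GL (Fin 2) T)}

/-- Every element of `G` is of the form `(1 + A) g`, with `A` in the kernel of `G` and `g` over
`k`. -/
theorem SquareZero.exists_decomposition (hπ : SquareZero π) (hG : G ≤ GL2D D T)
    (hι : ∀ g ∈ GL2D D k, constGL T g ∈ G) {x : GL (Fin 2) T} (hx : x ∈ G) :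
    ∃ A ∈ hπ.kernel G, redGL π x ∈ GL2D D k ∧
      (x : Matrix (Fin 2) (Fin 2) T) = (1 + A) * constGL T (redGL π x) := by
  have hr := redGL_mem_GL2D (π := π) (hG hx)
  refine ⟨(x : Matrix (Fin 2) (Fin 2) T) *
          ((constGL T (redGL π x))⁻¹ : GL (Fin 2) T) - 1, ⟨?_, x * (constGL T (redGL π x))⁻¹,
          G.mul_mem hx (G.inv_mem (hι _ hr)), by simp⟩, hr, ?_⟩
  · rw [sub_mem_matKer, ← Units.val_mul, ← coe_redGL, map_mul, map_inv, redGL_constGL,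
      mul_inv_cancel, map_one_matrix]
    rfl
  · rw [add_sub_cancel]
    exact (Units.inv_mul_cancel_right _ _).symm

theorem SquareZero.semidirect_equiv (hπ : SquareZero π) (hG : G ≤ GL2D D T)
    (hι : ∀ g ∈ GL2D D k, constGL T g ∈ G)
    {K V : Type*} [CommRing K] [AddCommGroup V] [Module K V]
    (σ : Representation K (GL2D D k) V) (θ : V →+ Matrix (Fin 2) (Fin 2) T)
    (hθ : Function.Injective θ) (hθG : θ.range = hπ.kernel G)
    (hσ : ∀ g v, θ (σ g v) = conj T (g : GL (Fin 2) k) (θ v)) :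
    Nonempty (G ≃* RepSemidirect σ) := by
  have hθN : ∀ v, θ v ∈ hπ.kernel G := fun v => hθG ▸ ⟨v, rfl⟩
  let θ' : V →+ MatKer π := θ.codRestrict (MatKer π).toAddSubmonoid (fun v => (hθN v).1)
  let f₁ : Multiplicative V →* GL (Fin 2) T := hπ.oneAddHom.comp (AddMonoidHom.toMultiplicative θ')
  have hf₁ : ∀ v, (f₁ v : Matrix (Fin 2) (Fin 2) T) = 1 + θ v.toAdd := fun v => rfl
  let f₂ : GL2D D k →* GL (Fin 2) T := (constGL T).comp (GL2D D k).subtype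
  have hcomp : ∀ g, f₁.comp ((repAut σ) g).toMonoidHom =
      (MulAut.conj (f₂ g)).toMonoidHom.comp f₁ := by
    intro g
    refine MonoidHom.ext fun v => Units.ext ?_
    simp only [MonoidHom.comp_apply, MulEquiv.coe_toMonoidHom, MulAut.conj_apply, Units.val_mul,
      hf₁]
    have e : θ (((repAut σ) g) v).toAdd = conj T (g : GL (Fin 2) k) (θ v.toAdd) := hσ g v.toAdd
    rw [e, mul_add, add_mul, mul_one, Units.mul_inv]
    rfl
  let f : RepSemidirect σ →* GL (Fin 2) T := SemidirectProduct.lift f₁ f₂ hcomp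
  have hf : ∀ x, f x = f₁ x.left * f₂ x.right := fun x => rfl
  have hred₁ : ∀ v, redGL π (f₁ v) = 1 := fun v => by
    refine Units.ext ?_
    rw [coe_redGL, hf₁, map_add_matrix, mem_matKer_iff_map.1 (hθN _).1, map_one_matrix]
    simp
  have hinj : Function.Injective f := by
    rw [injective_iff_map_eq_one]
    intro x hx
    rw [hf] at hx
    have h1 := congrArg (redGL π) hx
    rw [map_mul, hred₁, one_mul, map_one] at h1
    have h2 : x.right = 1 := Subtype.ext ((redGL_constGL (π := π) _).symm.trans h1)
    rw [h2, map_one, mul_one] at hx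
    have h3 := congrArg Units.val hx
    rw [hf₁, Units.val_one, add_eq_left, ← map_zero θ] at h3
    exact SemidirectProduct.ext (hθ h3) h2
  have hrange : f.range = G := by
    apply le_antisymm
    · rintro _ ⟨x, rfl⟩
      rw [hf]
      refine G.mul_mem ?_ (hι _ x.right.2)
      obtain ⟨-, g, hg, hgx⟩ := hθN x.left.toAdd
      have : f₁ x.left = g := Units.ext hgx.symm
      rwa [this]
    · intro x hx
      obtain ⟨A, hA, hr, hxA⟩ := hπ.exists_decomposition hG hι hx
      rw [← hθG] at hA
      obtain ⟨v, rfl⟩ := hA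
      exact ⟨⟨Multiplicative.ofAdd v, ⟨_, hr⟩⟩, Units.ext hxA.symm⟩
  exact ⟨((MulEquiv.subgroupCongr hrange).symm.trans (MonoidHom.ofInjective hinj).symm)⟩

end Semidirect

/-! ### Trace-zero matrices over a span as copies of `M₂⁰(k)` -/

section Combine

variable (p : ℕ) {k : Type*} [Field k] [Algebra (ZMod p) k] {T : Type*} [CommRing T] [Algebra k T]

/-- The matrix `∑ i, A i • b i` over `T`, for trace-zero matrices `A i` over `k` and elements `b i`
of `T`. -/
def combine {n : ℕ} (b : Fin n → T) :
    (Fin n → M20 p (⊤ : Ideal k)) →+ Matrix (Fin 2) (Fin 2) T where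
  toFun A := Matrix.of fun i j => ∑ l, (A l : Matrix (Fin 2) (Fin 2) k) i j • b l
  map_zero' := by
    ext
    simp
  map_add' A B := by
    ext
    simp [add_smul, Finset.sum_add_distrib]

variable {p}

theorem combine_apply {n : ℕ} (b : Fin n → T) (A : Fin n → M20 p (⊤ : Ideal k)) (i j : Fin 2) :
    combine p b A i j = ∑ l, (A l : Matrix (Fin 2) (Fin 2) k) i j • b l := rfl

theorem combine_conj {D : Subgroup kˣ} {n : ℕ} (b : Fin n → T) (g : GL2D D k)
    (A : Fin n → M20 p (⊤ : Ideal k)) :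
    combine p b (copies n (conjRep p D (⊤ : Ideal k)) g A) =
      conj T (g : GL (Fin 2) k) (combine p b A) := by
  ext i j
  rw [combine_apply, conj_entries]
  simp only [combine_apply, Finset.smul_sum]
  have h : ∀ l, ((copies n (conjRep p D (⊤ : Ideal k)) g A l : M20 p (⊤ : Ideal k)) :
      Matrix (Fin 2) (Fin 2) k) i j = conj k (g : GL (Fin 2) k) (A l) i j := fun l => rfl
  simp only [h, conj_entries, Finset.sum_smul, smul_eq_mul, mul_smul]
  rw [Finset.sum_comm]
  refine Finset.sum_congr rfl fun l _ => ?_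
  rw [Finset.sum_comm]

theorem M20_apply_one_one {R : Type*} [CommRing R] [Algebra (ZMod p) R] {I : Ideal R}
    (A : M20 p I) : (A : Matrix (Fin 2) (Fin 2) R) 1 1 = - (A : Matrix (Fin 2) (Fin 2) R) 0 0 := by
  have := A.2.2
  rw [Matrix.trace_fin_two] at this
  exact eq_neg_of_add_eq_zero_right this

theorem M20_ext_zero {R : Type*} [CommRing R] [Algebra (ZMod p) R] {I : Ideal R}
    {A : M20 p I} (h0 : (A : Matrix (Fin 2) (Fin 2) R) 0 0 = 0)
    (h1 : (A : Matrix (Fin 2) (Fin 2) R) 0 1 = 0) (h2 : (A : Matrix (Fin 2) (Fin 2) R) 1 0 = 0) :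
    A = 0 := by
  refine Subtype.ext ?_
  have h3 := M20_apply_one_one A
  ext i j
  fin_cases i <;> fin_cases j <;> simp [h0, h1, h2, h3]

/-- The trace-zero matrix over `k` with three given entries. -/
def M20.mk3 (p : ℕ) [Algebra (ZMod p) k] (x y z : k) : M20 p (⊤ : Ideal k) :=
  ⟨!![x, y; z, -x], fun _ _ => trivial, by simp [Matrix.trace_fin_two]⟩

theorem combine_injective {n : ℕ} {b : Fin n → T} (hb : LinearIndependent k b) :
    Function.Injective (combine p (k := k) b) := by
  rw [injective_iff_map_eq_zero]
  intro A hA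
  have h : ∀ i j l, (A l : Matrix (Fin 2) (Fin 2) k) i j = 0 := fun i j =>
    Fintype.linearIndependent_iff.1 hb _ (congrFun (congrFun hA i) j)
  funext l
  exact M20_ext_zero (h _ _ _) (h _ _ _) (h _ _ _)

theorem mem_range_combine {n : ℕ} {b : Fin n → T} {A : Matrix (Fin 2) (Fin 2) T}
    (hA : A.trace = 0) (hAb : ∀ i j, A i j ∈ Submodule.span k (Set.range b)) :
    A ∈ (combine p (k := k) b).range := by
  simp only [Submodule.mem_span_range_iff_exists_fun] at hAb
  choose c hc using hAb
  refine ⟨fun l => M20.mk3 p (c 0 0 l) (c 0 1 l) (c 1 0 l), ?_⟩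
  rw [Matrix.trace_fin_two] at hA
  ext i j
  rw [combine_apply]
  fin_cases i <;> fin_cases j <;> simp [M20.mk3, hc]
  exact (eq_neg_of_add_eq_zero_right hA).symm

theorem combine_mem_span {n : ℕ} (b : Fin n → T) (A : Fin n → M20 p (⊤ : Ideal k)) (i j : Fin 2) :
    combine p b A i j ∈ Submodule.span k (Set.range b) := by
  rw [combine_apply]
  exact Submodule.sum_mem _ fun l _ => Submodule.smul_mem _ _ (Submodule.subset_span (Set.mem_range_self l))

theorem trace_combine {n : ℕ} (b : Fin n → T) (A : Fin n → M20 p (⊤ : Ideal k)) :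
    (combine p b A).trace = 0 := by
  rw [Matrix.trace_fin_two, combine_apply, combine_apply, ← Finset.sum_add_distrib]
  refine Finset.sum_eq_zero fun l _ => ?_
  rw [M20_apply_one_one, neg_smul, add_neg_cancel]

end Combine

/-! ### The full group `GL₂ᴰ(T)` -/

section Odd

variable {p : ℕ} {k : Type*} [Field k] [Algebra (ZMod p) k] {T : Type*} [CommRing T]
  [Algebra k T] {π : T →ₐ[k] k} {D : Subgroup kˣ}

theorem SquareZero.mem_kernel_GL2D (hπ : SquareZero π) {A : Matrix (Fin 2) (Fin 2) T} :
    A ∈ hπ.kernel (GL2D D T) ↔ A ∈ MatKer π ∧ A.trace = 0 := by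
  constructor
  · rintro ⟨hA, g, hg, hgA⟩
    exact ⟨hA, hπ.trace_eq_zero_of_one_add_mem hA hgA hg⟩
  · rintro ⟨hA, htr⟩
    obtain ⟨g, hg, -⟩ := hπ.exists_one_add hA
    exact ⟨hA, g, hπ.one_add_mem_GL2D hA hg htr, hg⟩

theorem SquareZero.GL2D_semidirect_equiv (hπ : SquareZero π) [Module.Finite k T] {m : ℕ}
    (hm : m = Module.finrank k (LinearMap.ker π.toLinearMap)) :
    Nonempty (GL2D D T ≃* RepSemidirect (copies m (conjRep p D (⊤ : Ideal k)))) := by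
  subst hm
  have hspan := (Module.finBasis k (LinearMap.ker π.toLinearMap)).span_eq
  set b := Module.finBasis k (LinearMap.ker π.toLinearMap)
  set b' : _ → T := fun i => (b i : T) with hb'
  have hli : LinearIndependent k b' :=
    b.linearIndependent.map' (LinearMap.ker π.toLinearMap).subtype (Submodule.ker_subtype _)
  have hspan' : Submodule.span k (Set.range b') = LinearMap.ker π.toLinearMap := by
    have := congrArg (Submodule.map (LinearMap.ker π.toLinearMap).subtype) hspan
    rw [Submodule.map_span, ← Set.range_comp, Submodule.map_top, Submodule.range_subtype] at this
    exact this
  refine hπ.semidirect_equiv le_rfl (fun g hg => constGL_mem_GL2D hg) _ (combine p b')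
    (combine_injective hli) ?_ (combine_conj b')
  ext A
  rw [hπ.mem_kernel_GL2D]
  constructor
  · rintro ⟨A, rfl⟩
    refine ⟨fun i j => ?_, trace_combine _ _⟩
    have := combine_mem_span b' A i j
    rw [hspan'] at this
    exact this
  · rintro ⟨h1, h2⟩
    refine mem_range_combine h2 fun i j => ?_
    rw [hspan']
    exact h1 i j

end Odd

/-! ### Traces of a group containing `GL₂ᴰ(k)` -/

section Traces

variable {k : Type*} [Field k] {T : Type*} [CommRing T] [Algebra k T] {π : T →ₐ[k] k}
  {D : Subgroup kˣ} {G : Subgroup (GL (Fin 2) T)}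

/-- The set of traces of a group of matrices. -/
def traceSet (G : Subgroup (GL (Fin 2) T)) : Set T :=
  {x | ∃ g ∈ G, (g : Matrix (Fin 2) (Fin 2) T).trace = x}

theorem trace_one_add_mul_constGL (A : Matrix (Fin 2) (Fin 2) T) (g : GL (Fin 2) k) :
    ((1 + A) * (constGL T g : Matrix (Fin 2) (Fin 2) T)).trace =
      algebraMap k T (g : Matrix (Fin 2) (Fin 2) k).trace +
        (g 0 0 • A 0 0 + g 1 0 • A 0 1 + g 0 1 • A 1 0 + g 1 1 • A 1 1) := by
  rw [add_mul, one_mul, Matrix.trace_add, coe_constGL]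
  congr 1
  · simp [Matrix.trace_fin_two]
  · simp only [Matrix.trace_fin_two, Matrix.mul_apply, Fin.sum_univ_two, Matrix.map_apply,
      Algebra.smul_def]
    ring

/-- An element of `SL₂` with given trace. -/
def companion {R : Type*} [CommRing R] (a : R) : GL (Fin 2) R :=
  ⟨!![a, 1; -1, 0], !![0, -1; 1, a], by simp [Matrix.one_fin_two], by simp [Matrix.one_fin_two]⟩

theorem coe_companion {R : Type*} [CommRing R] (a : R) :
    (companion a : Matrix (Fin 2) (Fin 2) R) = !![a, 1; -1, 0] := rfl

theorem companion_mem_GL2D (a : T) : companion a ∈ GL2D D T := by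
  rw [mem_GL2D]
  exact ⟨1, D.one_mem, by simp [coe_companion]⟩

theorem traceSet_GL2D : traceSet (GL2D D T) = Set.univ := by
  rw [Set.eq_univ_iff_forall]
  exact fun x => ⟨_, companion_mem_GL2D x, by simp [coe_companion, Matrix.trace_fin_two]⟩

theorem traceSet_conj (G : Subgroup (GL (Fin 2) T)) (P : GL (Fin 2) T) :
    traceSet (G.map (MulAut.conj P).toMonoidHom) = traceSet G := by
  have h : ∀ g : GL (Fin 2) T, ((P * g * P⁻¹ : GL (Fin 2) T) : Matrix (Fin 2) (Fin 2) T).trace =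
      (g : Matrix (Fin 2) (Fin 2) T).trace := fun g => by
    rw [Units.val_mul, Matrix.trace_mul_comm, ← Units.val_mul, ← mul_assoc, inv_mul_cancel, one_mul]
  ext x
  constructor
  · rintro ⟨_, ⟨g, hg, rfl⟩, hx⟩
    exact ⟨g, hg, (h g).symm.trans hx⟩
  · rintro ⟨g, hg, hx⟩
    exact ⟨_, ⟨g, hg, rfl⟩, (h g).trans hx⟩

variable [Finite k]

namespace SquareZero

/-- The off-diagonal contributions fall into the subspace `W`. The diagonal part enters only through
`g 0 0 - g 1 1`, which in characteristic two is the trace of `g`. -/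
theorem trace_mem (hπ : SquareZero π) (hG : G ≤ GL2D D T)
    (hι : ∀ g ∈ GL2D D k, constGL T g ∈ G) (hN : IsStable D (hπ.kernel G))
    (h2 : ∃ a : kˣ, (a : k) ^ 2 ≠ 1) {x : T} (hx : x ∈ traceSet G) :
    ∃ y ∈ hN.diagPart, ∃ z ∈ hN.offDiag, ∃ g : GL (Fin 2) k, π x = g 0 0 + g 1 1 ∧
      x = algebraMap k T (π x) + ((g 0 0 - g 1 1) • y + z) := by
  obtain ⟨g, hg, rfl⟩ := hx
  obtain ⟨A, hA, -, hgA⟩ := hπ.exists_decomposition hG hι hg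
  obtain ⟨e0, e1, e2, e3⟩ := (hN.mem_iff h2).1 hA
  refine ⟨A 0 0, e0, redGL π g 1 0 • A 0 1 + redGL π g 0 1 • A 1 0,
    hN.offDiag.add_mem (hN.offDiag.smul_mem _ e1) (hN.offDiag.smul_mem _ e2), redGL π g, ?_, ?_⟩
  · rw [Matrix.trace_fin_two, map_add]
    rfl
  · have htr : π (g : Matrix (Fin 2) (Fin 2) T).trace =
        (redGL π g : Matrix (Fin 2) (Fin 2) k).trace := by
      rw [Matrix.trace_fin_two, Matrix.trace_fin_two, map_add]
      rfl
    rw [htr]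
    conv_lhs => rw [hgA]
    rw [trace_one_add_mul_constGL, e3]
    module

theorem eq_GL2D_of_adjoin_eq_top (hπ : SquareZero π) (hG : G ≤ GL2D D T)
    (hι : ∀ g ∈ GL2D D k, constGL T g ∈ G) (hN : IsStable D (hπ.kernel G))
    (h2 : ∃ a : kˣ, (a : k) ^ 2 ≠ 1) (h20 : (2 : k) ≠ 0)
    (htop : Algebra.adjoin k (traceSet G) = ⊤) : G = GL2D D T := by
  have hker : ∀ x, π x = 0 → x ∈ hN.offDiag := by
    -- This is `k + W`, closed under multiplication because `𝔪² = 0`. It contains all traces, hence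
    -- is all of `T`.
    let S : Subalgebra k T :=
      { carrier := {x | x - algebraMap k T (π x) ∈ hN.offDiag}
        add_mem' := fun {x y} hx hy => by
          have := hN.offDiag.add_mem hx hy
          show x + y - algebraMap k T (π (x + y)) ∈ hN.offDiag
          rw [map_add, map_add]
          convert this using 1
          ring
        mul_mem' := fun {x y} hx hy => by
          have h0 := hπ (x - algebraMap k T (π x)) (y - algebraMap k T (π y)) (by simp) (by simp)
          have := hN.offDiag.add_mem (hN.offDiag.smul_mem (π x) hy) (hN.offDiag.smul_mem (π y) hx)
          show x * y - algebraMap k T (π (x * y)) ∈ hN.offDiag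
          convert this using 1
          rw [map_mul, map_mul, Algebra.smul_def, Algebra.smul_def]
          linear_combination h0
        algebraMap_mem' := fun r => by simp }
    have hS : traceSet G ⊆ S := by
      intro x hx
      obtain ⟨y, hy, z, hz, g, -, hxe⟩ := hπ.trace_mem hG hι hN h2 hx
      show x - algebraMap k T (π x) ∈ hN.offDiag
      rw [sub_eq_iff_eq_add'.2 hxe]
      rw [hN.diagPart_eq_offDiagPart h2 h20] at hy
      exact hN.offDiag.add_mem (hN.offDiag.smul_mem _ hy) hz
    intro x hx
    have hxS : x ∈ S := by
      have : x ∈ Algebra.adjoin k (traceSet G) := htop ▸ Algebra.mem_top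
      exact Algebra.adjoin_le hS this
    have h : x - algebraMap k T (π x) ∈ hN.offDiag := hxS
    rwa [hx, map_zero, sub_zero] at h
  refine le_antisymm hG fun x hx => ?_
  obtain ⟨A, hA, hr, hxA⟩ := hπ.exists_decomposition le_rfl (fun g hg => constGL_mem_GL2D hg) hx
  obtain ⟨hAK, htr⟩ := hπ.mem_kernel_GL2D.1 hA
  have hAG : A ∈ hπ.kernel G := by
    rw [hN.mem_iff h2]
    rw [Matrix.trace_fin_two] at htr
    exact ⟨hN.offDiag_le_diagPart (hker _ (hAK _ _)), hker _ (hAK _ _), hker _ (hAK _ _),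
      eq_neg_of_add_eq_zero_right htr⟩
  obtain ⟨-, g, hg, hgA⟩ := hAG
  have : x = g * constGL T (redGL π x) := Units.ext (by rw [hxA, Units.val_mul, hgA])
  rw [this]
  exact G.mul_mem hg (hι _ hr)

theorem traceSet_eq_of_char_two (hπ : SquareZero π) (hG : G ≤ GL2D D T)
    (hι : ∀ g ∈ GL2D D k, constGL T g ∈ G) (hN : IsStable D (hπ.kernel G))
    (h2 : ∃ a : kˣ, (a : k) ^ 2 ≠ 1) (h20 : (2 : k) = 0) :
    traceSet G = (hN.offDiag : Set T) ∪
      Set.range fun y : kˣ × hN.diagPart => (y.1 : k) • (1 + (y.2 : T)) := by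
  have hsub : ∀ a b : k, a - b = a + b := fun a b => by
    linear_combination - b * h20
  ext x
  constructor
  · intro hx
    obtain ⟨y, hy, z, hz, g, hg, hxe⟩ := hπ.trace_mem hG hι hN h2 hx
    rw [hsub, ← hg] at hxe
    by_cases h0 : π x = 0
    · left
      rw [hxe, h0]
      simpa using hz
    -- As `W ⊆ X`, the term `z` is absorbed into `X` after dividing by the nonzero residue `π x`.
    · right
      refine ⟨⟨Units.mk0 _ h0, ⟨y + (π x)⁻¹ • z, hN.diagPart.add_mem hy
        (hN.offDiag_le_diagPart (hN.offDiag.smul_mem _ hz))⟩⟩, ?_⟩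
      conv_rhs => rw [hxe]
      simp only [Units.val_mk0, smul_add, smul_smul, mul_inv_cancel₀ h0, one_smul]
      rw [Algebra.algebraMap_eq_smul_one]
  · have hmul : ∀ A ∈ hπ.kernel G, ∀ g ∈ GL2D D k, algebraMap k T (g : Matrix (Fin 2) (Fin 2) k).trace +
        (g 0 0 • A 0 0 + g 1 0 • A 0 1 + g 0 1 • A 1 0 + g 1 1 • A 1 1) ∈ traceSet G := by
      rintro A ⟨-, h, hh, hA⟩ g hg
      refine ⟨h * constGL T g, G.mul_mem hh (hι g hg), ?_⟩
      rw [Units.val_mul, hA, trace_one_add_mul_constGL]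
    rintro (hx | ⟨⟨a, y, hy⟩, rfl⟩)
    -- The companion matrix of trace zero has lower left entry `-1`, which the sign of `-x`
    -- compensates.
    · have := hmul _ (hN.mem_offDiag.1 (hN.offDiag.neg_mem hx)) _ (companion_mem_GL2D 0)
      simpa [coe_companion, Matrix.trace_fin_two] using this
    · have := hmul _ (hN.mem_diagPart.1 hy) _ (companion_mem_GL2D (a : k))
      simpa [coe_companion, Matrix.trace_fin_two, smul_add, Algebra.algebraMap_eq_smul_one] using this

theorem ncard_traceSet_of_char_two (hπ : SquareZero π) [Finite T] (hG : G ≤ GL2D D T)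
    (hι : ∀ g ∈ GL2D D k, constGL T g ∈ G) (hN : IsStable D (hπ.kernel G))
    (h2 : ∃ a : kˣ, (a : k) ^ 2 ≠ 1) (h20 : (2 : k) = 0) :
    (traceSet G).ncard = Nat.card hN.offDiag + (Nat.card k - 1) * Nat.card hN.diagPart := by
  have hπval : ∀ y : kˣ × hN.diagPart, π ((y.1 : k) • (1 + (y.2 : T))) = y.1 := fun y => by
    rw [map_smul, map_add, hπ.diagPart_le_ker hN y.2.2]
    simp
  rw [hπ.traceSet_eq_of_char_two hG hι hN h2 h20, Set.ncard_union_eq]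
  · rw [← Set.image_univ, Set.ncard_image_of_injective, Set.ncard_univ, Nat.card_prod,
      Nat.card_units]
    · rfl
    · intro y z hyz
      have h1 := congrArg π hyz
      simp only [hπval] at h1
      have h3 : y.1 = z.1 := Units.ext h1
      simp only [h3] at hyz
      have h4 := (smul_right_injective T z.1.ne_zero) hyz
      exact Prod.ext h3 (Subtype.ext (add_left_cancel h4))
  · rw [Set.disjoint_left]
    rintro _ hx ⟨y, rfl⟩
    have h := hπ.offDiag_le_ker hN hx
    simp only [hπval] at h
    exact y.1.ne_zero h

end SquareZero

end Traces

/-! ### Subrepresentations of `M₂⁰(I)` as groups of matrices -/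

section Subrep

variable {p : ℕ} {k : Type*} [Field k] {T : Type*} [CommRing T]
  [Algebra k T] [Algebra (ZMod p) T] {D : Subgroup kˣ} {I : Ideal T}

/-- The group of matrices underlying a subrepresentation of `M₂⁰(I)`. -/
def matrices (M : Subrepresentation (conjRep p D I)) : AddSubgroup (Matrix (Fin 2) (Fin 2) T) :=
  (M.toSubmodule.map (M20 p I).subtype).toAddSubgroup

theorem mem_matrices {M : Subrepresentation (conjRep p D I)} {A : Matrix (Fin 2) (Fin 2) T} :
    A ∈ matrices M ↔ ∃ h : A ∈ M20 p I, ⟨A, h⟩ ∈ M.toSubmodule := by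
  constructor
  · rintro ⟨A, hA, rfl⟩
    exact ⟨A.2, hA⟩
  · rintro ⟨h, hA⟩
    exact ⟨_, hA, rfl⟩

theorem coe_mem_matrices {M : Subrepresentation (conjRep p D I)} {A : M20 p I} :
    (A : Matrix (Fin 2) (Fin 2) T) ∈ matrices M ↔ A ∈ M.toSubmodule := by
  rw [mem_matrices]
  exact ⟨fun ⟨_, h⟩ => h, fun h => ⟨A.2, h⟩⟩

theorem isStable_matrices (M : Subrepresentation (conjRep p D I)) : IsStable D (matrices M) where
  trace := by
    rintro _ ⟨A, -, rfl⟩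
    exact A.2.2
  conj := by
    rintro g _ ⟨A, hA, rfl⟩
    exact ⟨_, M.apply_mem_toSubmodule g hA, rfl⟩

/-- A stable group of matrices over `I` comes from a subrepresentation. -/
theorem exists_subrepresentation {N : AddSubgroup (Matrix (Fin 2) (Fin 2) T)} (hN : IsStable D N)
    (hI : ∀ A ∈ N, ∀ i j, A i j ∈ I) :
    ∃ M : Subrepresentation (conjRep p D I), matrices M = N := by
  refine ⟨⟨(AddSubgroup.toZModSubmodule p N).comap (M20 p I).subtype, fun g A hA => hN.conj g _ hA⟩,
    ?_⟩
  ext A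
  rw [mem_matrices]
  exact ⟨fun ⟨_, h⟩ => h, fun h => ⟨⟨hI A h, hN.trace A h⟩, h⟩⟩

theorem diagPart_matrices_le {M : Subrepresentation (conjRep p D I)} {x : T}
    (hx : x ∈ (isStable_matrices M).diagPart) : x ∈ I := by
  obtain ⟨h, -⟩ := mem_matrices.1 hx
  simpa using h.1 0 0

theorem scalar_tower_zmod [Algebra (ZMod p) k] : IsScalarTower (ZMod p) k T :=
  IsScalarTower.of_algebraMap_eq' (Subsingleton.elim _ _)

end Subrep

/-! ### Module structure in characteristic two -/

section CharTwo

variable {k : Type*} [Field k] [Algebra (ZMod 2) k] {D : Subgroup kˣ}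

theorem two_eq_zero_of_algebra (R : Type*) [CommRing R] [Algebra (ZMod 2) R] : (2 : R) = 0 := by
  have := congrArg (algebraMap (ZMod 2) R) (show (2 : ZMod 2) = 0 from rfl)
  rwa [map_ofNat, map_zero] at this

theorem neg_eq_of_algebra {R : Type*} [CommRing R] [Algebra (ZMod 2) R] (x : R) : -x = x := by
  linear_combination -x * two_eq_zero_of_algebra R

variable (D) in
/-- The two scalar matrices with entries in the prime field of characteristic two. -/
def primeScalars : Subrepresentation (conjRep 2 D (⊤ : Ideal k)) where
  toSubmodule := (LinearMap.range (Algebra.linearMap (ZMod 2) (Matrix (Fin 2) (Fin 2) k))).comap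
    (M20 2 (⊤ : Ideal k)).subtype
  apply_mem_toSubmodule := by
    rintro g A ⟨n, hn⟩
    refine ⟨n, ?_⟩
    have h1 : algebraMap (ZMod 2) (Matrix (Fin 2) (Fin 2) k) n =
        Matrix.scalar (Fin 2) (algebraMap (ZMod 2) k n) := rfl
    have h2 : ((A : M20 2 (⊤ : Ideal k)) : Matrix (Fin 2) (Fin 2) k) =
        Matrix.scalar (Fin 2) (algebraMap (ZMod 2) k n) := hn.symm
    show _ = conj k (g : GL (Fin 2) k) (A : Matrix (Fin 2) (Fin 2) k)
    rw [h2, conj_scalar]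
    rfl

theorem mem_primeScalars {A : M20 2 (⊤ : Ideal k)} :
    A ∈ (primeScalars D).toSubmodule ↔
      ∃ n : ZMod 2, (A : Matrix (Fin 2) (Fin 2) k) =
        Matrix.scalar (Fin 2) (algebraMap (ZMod 2) k n) :=
  ⟨fun ⟨n, h⟩ => ⟨n, h.symm⟩, fun ⟨n, h⟩ => ⟨n, h.symm⟩⟩

/-- The element of `primeScalars` given by an element of the prime field. -/
def primeScalar (D : Subgroup kˣ) (n : ZMod 2) : (primeScalars D).toSubmodule :=
  ⟨⟨Matrix.scalar (Fin 2) (algebraMap (ZMod 2) k n), fun _ _ => trivial, by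
    rw [Matrix.trace_fin_two]
    simp [← two_mul, two_eq_zero_of_algebra k]⟩, mem_primeScalars.2 ⟨n, rfl⟩⟩

theorem card_primeScalars : Nat.card (primeScalars D).toSubmodule = 2 := by
  have : Function.Bijective (primeScalar D) := by
    refine ⟨fun m n h => ?_, fun A => ?_⟩
    · have h1 := congrArg (fun A : (primeScalars D).toSubmodule =>
        ((A : M20 2 (⊤ : Ideal k)) : Matrix (Fin 2) (Fin 2) k) 0 0) h
      simpa [primeScalar] using h1
    · obtain ⟨n, hn⟩ := mem_primeScalars.1 A.2
      exact ⟨n, Subtype.ext (Subtype.ext hn.symm)⟩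
  rw [← Nat.card_eq_of_bijective _ this, Nat.card_zmod]

variable {T : Type*} [CommRing T] [Algebra k T] [Algebra (ZMod 2) T] {I : Ideal T}

/-- In characteristic two, a subrepresentation of `M₂⁰(I)` is of the type given by its diagonal and
off-diagonal parts. -/
theorem isOfType_of_char_two [Finite k] [Finite T] (h2 : ∃ a : kˣ, (a : k) ^ 2 ≠ 1)
    (M : Subrepresentation (conjRep 2 D I)) :
    ∃ β : ℕ, Nat.card (isStable_matrices M).diagPart =
        Nat.card (isStable_matrices M).offDiag * 2 ^ β ∧
      IsOfType 2 D M.toRepresentation (Module.finrank k (isStable_matrices M).offDiag) β := by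
  have hN := isStable_matrices M
  have := scalar_tower_zmod (p := 2) (k := k) (T := T)
  set W : Submodule (ZMod 2) T := (isStable_matrices M).offDiag.restrictScalars (ZMod 2) with hW
  set X₀ : Submodule (ZMod 2) T := AddSubgroup.toZModSubmodule 2 (isStable_matrices M).diagPart
  have hWX : W ≤ X₀ := fun x hx => hN.offDiag_le_diagPart hx
  -- `X₀` is only an `𝔽₂`-space, so the complement is taken over the prime field. Intersecting it
  -- with `X₀` gives `X₀ = W ⊕ X`.
  obtain ⟨Y, hY⟩ := exists_isCompl W
  set X : Submodule (ZMod 2) T := Y ⊓ X₀ with hX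
  have hdisj : ∀ x ∈ W, ∀ y ∈ X, x + y = 0 → x = 0 ∧ y = 0 := by
    intro x hx y hy hxy
    have h1 : x = -y := eq_neg_of_add_eq_zero_left hxy
    have h3 : x ∈ W ⊓ Y := ⟨hx, h1 ▸ Y.neg_mem hy.1⟩
    rw [hY.inf_eq_bot, Submodule.mem_bot] at h3
    rw [h3, zero_add] at hxy
    exact ⟨h3, hxy⟩
  have hsum : ∀ x ∈ X₀, ∃ w ∈ W, ∃ y ∈ X, w + y = x := by
    intro x hx
    have : x ∈ W ⊔ Y := hY.sup_eq_top ▸ Submodule.mem_top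
    obtain ⟨w, hw, y, hy, rfl⟩ := Submodule.mem_sup.1 this
    refine ⟨w, hw, y, ⟨hy, ?_⟩, rfl⟩
    have := X₀.sub_mem hx (hWX hw)
    rwa [add_sub_cancel_left] at this
  set b := Module.finBasis k (isStable_matrices M).offDiag
  set x := Module.finBasis (ZMod 2) X
  set b' : _ → T := fun i => (b i : T) with hb'
  set x' : _ → T := fun i => (x i : T) with hx'
  have hbli : LinearIndependent k b' :=
    b.linearIndependent.map' (isStable_matrices M).offDiag.subtype (Submodule.ker_subtype _)
  have hbspan : Submodule.span k (Set.range b') = (isStable_matrices M).offDiag := by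
    have := congrArg (Submodule.map (isStable_matrices M).offDiag.subtype) b.span_eq
    rwa [Submodule.map_span, ← Set.range_comp, Submodule.map_top, Submodule.range_subtype] at this
  refine ⟨Module.finrank (ZMod 2) X, ?_, primeScalars D, fun A hA => ?_, card_primeScalars, ?_⟩
  · have hcX : Nat.card X = 2 ^ Module.finrank (ZMod 2) X := by
      rw [Module.natCard_eq_pow_finrank (K := ZMod 2), Nat.card_zmod]
    rw [← hcX, ← Nat.card_prod]
    refine (Nat.card_eq_of_bijective (fun y : (isStable_matrices M).offDiag × X =>
      (⟨y.1 + y.2, X₀.add_mem (hWX y.1.2) y.2.2.2⟩ : (isStable_matrices M).diagPart))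
      ⟨fun y z hyz => ?_, fun y => ?_⟩).symm
    · have h1 : (y.1 : T) + y.2 = z.1 + z.2 := congrArg Subtype.val hyz
      obtain ⟨h3, h4⟩ := hdisj (y.1 - z.1) (W.sub_mem y.1.2 z.1.2) (y.2 - z.2)
        (X.sub_mem y.2.2 z.2.2) (by linear_combination h1)
      exact Prod.ext (Subtype.ext (sub_eq_zero.1 h3)) (Subtype.ext (sub_eq_zero.1 h4))
    · obtain ⟨w, hw, z, hz, h⟩ := hsum y y.2
      exact ⟨⟨⟨w, hw⟩, ⟨z, hz⟩⟩, Subtype.ext h⟩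
  · obtain ⟨n, hn⟩ := mem_primeScalars.1 hA
    exact ⟨_, hn⟩
  -- A `k`-basis of `W` contributes copies of `M₂⁰(k)`; an `𝔽₂`-basis of `X` contributes scalar
  -- lines of order two.
  · let ψ : (Fin (Module.finrank k (isStable_matrices M).offDiag) → M20 2 (⊤ : Ideal k)) ×
        (Fin (Module.finrank (ZMod 2) X) → (primeScalars D).toSubmodule) →+
        Matrix (Fin 2) (Fin 2) T :=
      (combine 2 b').coprod ((combine 2 x').comp
        (((primeScalars D).toSubmodule.subtype.compLeft _).toAddMonoidHom))
    have hψ : ∀ (A : _) (C : Fin (Module.finrank (ZMod 2) X) → (primeScalars D).toSubmodule),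
        ψ (A, C) = combine 2 b' A +
          combine 2 x' (fun i => ((C i : (primeScalars D).toSubmodule) : M20 2 (⊤ : Ideal k))) :=
      fun _ _ => rfl
    have hC : ∀ C : Fin (Module.finrank (ZMod 2) X) → (primeScalars D).toSubmodule,
        ∃ n : Fin (Module.finrank (ZMod 2) X) → ZMod 2, C = fun i => primeScalar D (n i) := by
      intro C
      choose n hn using fun i => mem_primeScalars.1 (C i).2
      exact ⟨n, funext fun i => Subtype.ext (Subtype.ext (hn i))⟩
    have hxC : ∀ n : Fin (Module.finrank (ZMod 2) X) → ZMod 2,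
        combine 2 x' (fun i => ((primeScalar D (n i) : (primeScalars D).toSubmodule) : M20 2 (⊤ : Ideal k))) =
          Matrix.scalar (Fin 2) ((∑ i, n i • x i : X) : T) := by
      intro n
      ext i j
      rw [combine_apply, Matrix.scalar_apply, Submodule.coe_sum]
      fin_cases i <;> fin_cases j <;> simp [primeScalar, hx']
    have hψM : ∀ v, ψ v ∈ matrices M := by
      rintro ⟨A, C⟩
      obtain ⟨n, rfl⟩ := hC C
      have hb : ∀ i j, combine 2 b' A i j ∈ W := fun i j => by
        have := combine_mem_span b' A i j
        rwa [hbspan] at this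
      rw [hψ, hxC, hN.mem_iff h2]
      have hy := (∑ i, n i • x i : X).2.2
      generalize ((∑ i, n i • x i : X) : T) = y at hy
      refine ⟨?_, ?_, ?_, ?_⟩
      · simp only [Matrix.add_apply, Matrix.scalar_apply, Matrix.diagonal_apply_eq]
        exact X₀.add_mem (hWX (hb 0 0)) hy
      · simpa using (show _ ∈ (isStable_matrices M).offDiag from hb 0 1)
      · simpa using (show _ ∈ (isStable_matrices M).offDiag from hb 1 0)
      · have h1 := trace_combine b' A
        rw [Matrix.trace_fin_two] at h1
        simp only [Matrix.add_apply, Matrix.scalar_apply, Matrix.diagonal_apply_eq]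
        linear_combination h1 + y * two_eq_zero_of_algebra T
    have hψI : ∀ v, ψ v ∈ M20 2 I := fun v => (mem_matrices.1 (hψM v)).1
    let ψ' : _ →+ M.toSubmodule := (ψ.codRestrict (M20 2 I).toAddSubmonoid hψI).codRestrict M.toSubmodule.toAddSubmonoid
      (fun v => (mem_matrices.1 (hψM v)).2)
    have hinj : Function.Injective ψ := by
      rw [injective_iff_map_eq_zero]
      rintro ⟨A, C⟩ h
      obtain ⟨n, rfl⟩ := hC C
      rw [hψ, hxC] at h
      set y := ∑ i, n i • x i with hy
      have h00 := congrFun (congrFun h 0) 0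
      have h01 := congrFun (congrFun h 0) 1
      have h10 := congrFun (congrFun h 1) 0
      have h11 := congrFun (congrFun h 1) 1
      simp only [Matrix.add_apply, Matrix.scalar_apply, Matrix.diagonal_apply_eq, Matrix.zero_apply,
        Matrix.diagonal_apply_ne _ zero_ne_one, Matrix.diagonal_apply_ne _ (one_ne_zero (α := Fin 2)),
        add_zero] at h00 h01 h10 h11
      have hb := combine_mem_span b' A 0 0
      rw [hbspan] at hb
      obtain ⟨h3, h4⟩ := hdisj _ hb y y.2 h00
      rw [h4, add_zero] at h11
      have hA : A = 0 := by
        refine combine_injective hbli ?_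
        rw [map_zero]
        ext i j
        fin_cases i <;> fin_cases j <;> assumption
      have hn : n = 0 := funext (Fintype.linearIndependent_iff.1 x.linearIndependent n
        (Subtype.ext h4))
      refine Prod.ext hA (funext fun i => Subtype.ext (Subtype.ext ?_))
      simp [hn, primeScalar]
    have hsurj : ∀ A ∈ matrices M, ∃ v, ψ v = A := by
      intro A hA
      obtain ⟨e0, e1, e2, e3⟩ := (hN.mem_iff h2).1 hA
      obtain ⟨w, hw, y, hy, hwy⟩ := hsum _ e0
      have hmem : !![w, A 0 1; A 1 0, -w] ∈ (combine 2 (k := k) b').range := by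
        refine mem_range_combine (by simp [Matrix.trace_fin_two]) ?_
        rw [hbspan]
        intro i j
        fin_cases i <;> fin_cases j
        · exact hw
        · exact e1
        · exact e2
        · exact W.neg_mem hw
      obtain ⟨B, hB⟩ := hmem
      refine ⟨(B, fun i => primeScalar D (x.repr ⟨y, hy⟩ i)), ?_⟩
      rw [hψ, hxC, hB, x.sum_repr]
      ext i j
      fin_cases i <;> fin_cases j <;> simp [hwy, e3]
      rw [← hwy, neg_add, neg_eq_of_algebra y]
    have hbij : Function.Bijective (AddMonoidHom.toZModLinearMap 2 ψ') := by
      constructor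
      · intro v w h
        exact hinj (congrArg (fun A : M.toSubmodule =>
          ((A : M20 2 I) : Matrix (Fin 2) (Fin 2) T)) h)
      · intro A
        obtain ⟨v, hv⟩ := hsurj _ (coe_mem_matrices.2 A.2)
        exact ⟨v, Subtype.ext (Subtype.ext hv)⟩
    refine ⟨(Representation.Equiv.mk (LinearEquiv.ofBijective _ hbij) fun g => ?_).symm⟩
    refine LinearMap.ext fun v => Subtype.ext (Subtype.ext ?_)
    show ψ _ = conj T (g : GL (Fin 2) k) (ψ v)
    obtain ⟨A, C⟩ := v
    rw [hψ, hψ A C, map_add, ← combine_conj, ← combine_conj]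
    rfl

end CharTwo

/-! ### Center of a semidirect product -/

section Center

variable {K G V : Type*} [CommRing K] [Group G] [AddCommGroup V] [Module K V]

theorem mem_center_repSemidirect {σ : Representation K G V}
    (hσ : ∀ g ∈ Subgroup.center G, ∀ v, σ g v = v) {x : RepSemidirect σ} :
    x ∈ Subgroup.center (RepSemidirect σ) ↔
      (∀ g, σ g x.left.toAdd = x.left.toAdd) ∧ x.right ∈ Subgroup.center G := by
  have hmul : ∀ x y : RepSemidirect σ,
      (x * y).left.toAdd = x.left.toAdd + σ x.right y.left.toAdd := fun _ _ => rfl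
  have hmul' : ∀ x y : RepSemidirect σ, (x * y).right = x.right * y.right := fun _ _ => rfl
  rw [Subgroup.mem_center_iff]
  constructor
  · intro h
    refine ⟨fun g => ?_, Subgroup.mem_center_iff.2 fun g => ?_⟩
    · have h1 := congrArg (fun y : RepSemidirect σ => y.left.toAdd) (h (SemidirectProduct.inr g))
      simp at h1
      exact h1
    · have h1 := congrArg (fun y : RepSemidirect σ => y.right) (h (SemidirectProduct.inr g))
      simpa [hmul'] using h1
  · rintro ⟨h1, h2⟩ y
    refine SemidirectProduct.ext (Multiplicative.toAdd.injective ?_) ?_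
    · rw [hmul, hmul, h1, hσ _ h2, add_comm]
    · rw [hmul', hmul', Subgroup.mem_center_iff.1 h2]

theorem card_center_repSemidirect {σ : Representation K G V}
    (hσ : ∀ g ∈ Subgroup.center G, ∀ v, σ g v = v) :
    Nat.card (Subgroup.center (RepSemidirect σ)) =
      Nat.card {v : V // ∀ g, σ g v = v} * Nat.card (Subgroup.center G) := by
  rw [← Nat.card_prod]
  refine Nat.card_congr
    { toFun := fun x => ⟨⟨x.1.left.toAdd, ((mem_center_repSemidirect hσ).1 x.2).1⟩,
        ⟨x.1.right, ((mem_center_repSemidirect hσ).1 x.2).2⟩⟩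
      invFun := fun y => ⟨⟨Multiplicative.ofAdd y.1.1, y.2.1⟩,
        (mem_center_repSemidirect hσ).2 ⟨y.1.2, y.2.2⟩⟩
      left_inv := fun x => rfl
      right_inv := fun y => rfl }

end Center

/-! ### Recovering the orders of the parts from the group -/

section CenterGL

variable {k : Type*} [Field k] {D : Subgroup kˣ} {T : Type*} [CommRing T] [Algebra k T]

/-- Commuting with one unipotent and the Weyl element already forces `g` to be scalar. -/
theorem conj_eq_of_mem_center {g : GL2D D k} (hg : g ∈ Subgroup.center (GL2D D k))
    (A : Matrix (Fin 2) (Fin 2) T) : conj T (g : GL (Fin 2) k) A = A := by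
  have hentry : ∀ h : GL2D D k, ∀ i j, (h * g : GL (Fin 2) k) i j = (g * h : GL (Fin 2) k) i j :=
    fun h i j => by
      have := congrArg Subtype.val (Subgroup.mem_center_iff.1 hg h)
      exact congrArg (fun x : GL (Fin 2) k => x i j) this
  have h1 := hentry (upperUnipD D 1) 0 0
  have h2 := hentry (upperUnipD D 1) 0 1
  have h3 := hentry (weylD D) 0 0
  simp [Matrix.mul_apply, Fin.sum_univ_two] at h1 h2 h3
  have hscalar : (constGL T (g : GL (Fin 2) k) : Matrix (Fin 2) (Fin 2) T) =
      Matrix.scalar (Fin 2) (algebraMap k T ((g : GL (Fin 2) k) 0 0)) := by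
    rw [coe_constGL]
    have h01 : (g : GL (Fin 2) k) 0 1 = 0 := by
      rw [h1] at h3
      exact neg_eq_zero.1 h3.symm
    have h11 : (g : GL (Fin 2) k) 1 1 = (g : GL (Fin 2) k) 0 0 := by
      linear_combination h2
    ext i j
    fin_cases i <;> fin_cases j <;> simp [h01, h1, h11]
  rw [conj_apply]
  have hcomm := (Matrix.scalar_commute (algebraMap k T ((g : GL (Fin 2) k) 0 0))
    (fun _ => Commute.all _ _) A).eq
  rw [← hscalar] at hcomm
  rw [hcomm]
  exact Units.mul_inv_cancel_right _ _

variable [Algebra (ZMod 2) T] {I : Ideal T}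

/-- Torus invariance kills the upper right entry and the Weyl element transports this to the lower
left. Conversely `diag(x, -x)` is scalar in characteristic two. -/
theorem invariants_iff (h2 : ∃ a : kˣ, (a : k) ^ 2 ≠ 1)
    {A : Matrix (Fin 2) (Fin 2) T} (htr : A.trace = 0) :
    (∀ g : GL2D D k, conj T (g : GL (Fin 2) k) A = A) ↔ A = !![A 0 0, 0; 0, -A 0 0] := by
  constructor
  · intro h
    obtain ⟨a, ha⟩ := h2
    have h1 := h (torusD D (antiDiag D a))
    rw [coe_torusD, conj_diagHom] at h1
    have h01 := congrFun (congrFun h1 0) 1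
    have hw := h (weylD D)
    rw [coe_weylD, conj_weyl] at hw
    have h10 := congrFun (congrFun hw 1) 0
    simp at h01 h10
    have h01' : A 0 1 = 0 := by
      refine (smul_eq_zero_iff_right (sub_ne_zero.2 ha)).1 ?_
      rw [sub_smul, pow_two, h01, one_smul, sub_self]
    rw [Matrix.trace_fin_two] at htr
    ext i j
    fin_cases i <;> fin_cases j <;> simp [h01', ← h10]
    exact eq_neg_of_add_eq_zero_right htr
  · intro h g
    have : A = Matrix.scalar (Fin 2) (A 0 0) := by
      rw [neg_eq_of_algebra] at h
      rw [h]
      ext i j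
      fin_cases i <;> fin_cases j <;> simp
    rw [this, conj_scalar]

theorem card_invariants (h2 : ∃ a : kˣ, (a : k) ^ 2 ≠ 1)
    (M : Subrepresentation (conjRep 2 D I)) :
    Nat.card {v : M.toSubmodule // ∀ g, M.toRepresentation g v = v} =
      Nat.card (isStable_matrices M).diagPart := by
  have hinv : ∀ v : M.toSubmodule, (∀ g, M.toRepresentation g v = v) ↔
      ∀ g : GL2D D k, conj T (g : GL (Fin 2) k) (v : M20 2 I) = (v : M20 2 I) := fun v =>
    forall_congr' fun g => ⟨fun h => congrArg (fun A : M.toSubmodule =>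
      ((A : M20 2 I) : Matrix (Fin 2) (Fin 2) T)) h, fun h => Subtype.ext (Subtype.ext h)⟩
  refine Nat.card_eq_of_bijective (fun v => ⟨((v : M.toSubmodule) : M20 2 I).1 0 0, ?_⟩)
    ⟨fun v w h => ?_, fun x => ?_⟩
  · have h1 := (invariants_iff h2 (v : M.toSubmodule).1.2.2).1 ((hinv _).1 v.2)
    rw [IsStable.mem_diagPart, ← h1]
    exact coe_mem_matrices.2 v.1.2
  · have h1 := (invariants_iff h2 (v : M.toSubmodule).1.2.2).1 ((hinv _).1 v.2)
    have h3 := (invariants_iff h2 (w : M.toSubmodule).1.2.2).1 ((hinv _).1 w.2)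
    have h4 : ((v : M.toSubmodule) : M20 2 I).1 0 0 = ((w : M.toSubmodule) : M20 2 I).1 0 0 :=
      congrArg Subtype.val h
    refine Subtype.ext (Subtype.ext (Subtype.ext ?_))
    rw [h1, h3, h4]
  · obtain ⟨hM, hx⟩ := mem_matrices.1 ((isStable_matrices M).mem_diagPart.1 x.2)
    refine ⟨⟨⟨_, hx⟩, (hinv _).2 ((invariants_iff h2 hM.2).2 (by simp))⟩, Subtype.ext (by simp)⟩

theorem card_subrepresentation [Finite k] (h2 : ∃ a : kˣ, (a : k) ^ 2 ≠ 1)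
    (M : Subrepresentation (conjRep 2 D I)) :
    Nat.card M.toSubmodule = Nat.card (isStable_matrices M).diagPart *
      (Nat.card (isStable_matrices M).offDiag * Nat.card (isStable_matrices M).offDiag) := by
  have hN := isStable_matrices M
  have hmem := fun A : M.toSubmodule => (hN.mem_iff h2).1 (coe_mem_matrices.2 A.2)
  rw [← Nat.card_prod, ← Nat.card_prod]
  refine Nat.card_eq_of_bijective (fun A => (⟨_, (hmem A).1⟩, ⟨_, (hmem A).2.1⟩,
    ⟨_, (hmem A).2.2.1⟩)) ⟨fun A B h => ?_, fun x => ?_⟩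
  · simp only [Prod.mk.injEq, Subtype.mk.injEq] at h
    refine Subtype.ext (Subtype.ext ?_)
    ext i j
    have hA := (hmem A).2.2.2
    have hB := (hmem B).2.2.2
    fin_cases i <;> fin_cases j
    · exact h.1
    · exact h.2.1
    · exact h.2.2
    · exact hA.trans ((congrArg Neg.neg h.1).trans hB.symm)
  · obtain ⟨x, y, z⟩ := x
    have hx : !![(x : T), y; z, -x] ∈ matrices M := by
      rw [hN.mem_iff h2]
      exact ⟨x.2, y.2, z.2, by simp⟩
    obtain ⟨hA, hA'⟩ := mem_matrices.1 hx
    exact ⟨⟨⟨_, hA⟩, hA'⟩, by simp⟩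

/-- In characteristic two, the isomorphism type of the semidirect product determines the orders of
the diagonal and off-diagonal parts. -/
theorem card_parts_eq_of_equiv [Finite k] [Finite T] (h2 : ∃ a : kˣ, (a : k) ^ 2 ≠ 1)
    {M M' : Subrepresentation (conjRep 2 D I)}
    (e : RepSemidirect M.toRepresentation ≃* RepSemidirect M'.toRepresentation) :
    Nat.card (isStable_matrices M).diagPart = Nat.card (isStable_matrices M').diagPart ∧
      Nat.card (isStable_matrices M).offDiag = Nat.card (isStable_matrices M').offDiag := by
  have htriv : ∀ M : Subrepresentation (conjRep 2 D I), ∀ g ∈ Subgroup.center (GL2D D k),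
      ∀ v, M.toRepresentation g v = v := fun M g hg v =>
    Subtype.ext (Subtype.ext (conj_eq_of_mem_center hg _))
  -- The center has order `|X| |Z(GL₂ᴰ(k))|`, which yields `|X|`; the order of the module is `|X|
  -- |W|²`, which then yields `|W|`.
  have hcenter := Nat.card_congr (Subgroup.centerCongr e).toEquiv
  rw [card_center_repSemidirect (htriv M), card_center_repSemidirect (htriv M'),
    card_invariants h2, card_invariants h2] at hcenter
  have hdiag := Nat.eq_of_mul_eq_mul_right Nat.card_pos hcenter
  have hcard := Nat.card_congr e.toEquiv
  rw [SemidirectProduct.card, SemidirectProduct.card] at hcard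
  have hcard' : Nat.card M.toSubmodule = Nat.card M'.toSubmodule :=
    Nat.eq_of_mul_eq_mul_right Nat.card_pos hcard
  rw [card_subrepresentation h2, card_subrepresentation h2, ← hdiag] at hcard'
  exact ⟨hdiag, Nat.mul_self_inj.1 (Nat.eq_of_mul_eq_mul_left Nat.card_pos hcard')⟩

end CenterGL

/-! ### Uniqueness of the exponents -/

section Numerics

theorem two_pow_mul_odd_injective {x y u v : ℕ} (hu : Odd u) (hv : Odd v)
    (h : 2 ^ x * u = 2 ^ y * v) : x = y ∧ u = v := by
  have key : ∀ {x y u v : ℕ}, Odd u → 2 ^ x * u = 2 ^ y * v → y ≤ x := by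
    intro x y u v hu h
    have h1 : 2 ^ y ∣ 2 ^ x := by
      refine Nat.Coprime.dvd_of_dvd_mul_right ?_ (Dvd.intro v h.symm)
      exact Nat.Coprime.pow_left _ (Nat.coprime_two_left.2 hu)
    exact (Nat.pow_dvd_pow_iff_le_right (by norm_num)).1 h1
  have hxy := le_antisymm (key hv h.symm) (key hu h)
  subst hxy
  exact ⟨rfl, Nat.eq_of_mul_eq_mul_left (by positivity) h⟩

theorem exponents_unique {d a b a' b' : ℕ} (hd : 0 < d)
    (h : (2 ^ d) ^ a * ((2 ^ d - 1) * 2 ^ b + 1) = (2 ^ d) ^ a' * ((2 ^ d - 1) * 2 ^ b' + 1)) :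
    a = a' ∧ b = b' := by
  obtain ⟨n, hn⟩ : ∃ n, 2 ^ d = n + 1 ∧ 0 < n := by
    have : 1 < 2 ^ d := Nat.one_lt_two_pow hd.ne'
    exact ⟨2 ^ d - 1, by omega, by omega⟩
  have hsub : 2 ^ d - 1 = n := by omega
  -- For `b = 0` the second factor is `2 ^ d` itself and raises the power of two; for `b > 0` it is
  -- odd and greater than `1`. The odd part thus separates the two cases.
  have hform : ∀ a b : ℕ, ∃ x u, (2 ^ d) ^ a * ((2 ^ d - 1) * 2 ^ b + 1) = 2 ^ x * u ∧ Odd u ∧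
      (b = 0 ∧ x = d * (a + 1) ∧ u = 1 ∨ b ≠ 0 ∧ x = d * a ∧ u = n * 2 ^ b + 1) := by
    intro a b
    rcases Nat.eq_zero_or_pos b with rfl | hb
    · refine ⟨d * (a + 1), 1, ?_, odd_one, Or.inl ⟨rfl, rfl, rfl⟩⟩
      rw [hsub, pow_zero, mul_one, ← hn.1, pow_mul, mul_one, pow_succ]
    · refine ⟨d * a, n * 2 ^ b + 1, ?_, ?_, Or.inr ⟨hb.ne', rfl, rfl⟩⟩
      · rw [hsub, pow_mul]
      · exact ((even_two.pow_of_ne_zero hb.ne').mul_left n).add_one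
  obtain ⟨x, u, e, hu, H⟩ := hform a b
  obtain ⟨x', u', e', hu', H'⟩ := hform a' b'
  obtain ⟨rfl, rfl⟩ := two_pow_mul_odd_injective hu hu' (e.symm.trans (h.trans e'))
  have hpos : ∀ b : ℕ, 0 < n * 2 ^ b := fun b => Nat.mul_pos hn.2 (by positivity)
  rcases H with ⟨h1, h2, h3⟩ | ⟨h1, h2, h3⟩ <;> rcases H' with ⟨h1', h2', h3'⟩ | ⟨h1', h2', h3'⟩
  · have := Nat.eq_of_mul_eq_mul_left hd (h2.symm.trans h2')
    omega
  · have := hpos b'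
    omega
  · have := hpos b
    omega
  · refine ⟨Nat.eq_of_mul_eq_mul_left hd (h2.symm.trans h2'), ?_⟩
    have h4 : n * 2 ^ b = n * 2 ^ b' := by omega
    exact Nat.pow_right_injective le_rfl (Nat.eq_of_mul_eq_mul_left hn.2 h4)

end Numerics

/-! ### Reduction to the coefficient field -/

section ResidueField

variable {k : Type*} [Field k] {T : Type*} [CommRing T] [IsLocalRing T] [Algebra k T]

/-- The reduction `T → k`, when the residue field of `T` is `k`. -/
noncomputable def residueHom
    (hres : Function.Bijective (algebraMap k (IsLocalRing.ResidueField T))) : T →ₐ[k] k :=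
  ((AlgEquiv.ofBijective (Algebra.ofId k (IsLocalRing.ResidueField T)) hres).symm.toAlgHom).comp
    (IsScalarTower.toAlgHom k T (IsLocalRing.ResidueField T))

variable (hres : Function.Bijective (algebraMap k (IsLocalRing.ResidueField T)))

theorem algebraMap_residueHom (x : T) :
    algebraMap k (IsLocalRing.ResidueField T) (residueHom hres x) = IsLocalRing.residue T x :=
  (AlgEquiv.ofBijective (Algebra.ofId k (IsLocalRing.ResidueField T)) hres).apply_symm_apply _

theorem residueHom_eq_zero {x : T} :
    residueHom hres x = 0 ↔ x ∈ IsLocalRing.maximalIdeal T := by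
  rw [← IsLocalRing.residue_eq_zero_iff, ← algebraMap_residueHom hres,
    map_eq_zero_iff _ hres.injective]

theorem squareZero_residueHom (hsq : IsLocalRing.maximalIdeal T ^ 2 = ⊥) :
    SquareZero (residueHom hres) := by
  intro x y hx hy
  rw [residueHom_eq_zero] at hx hy
  have := Ideal.mul_mem_mul hx hy
  rwa [← pow_two, hsq, Ideal.mem_bot] at this

/-- The maximal ideal is the kernel of the reduction. -/
noncomputable def maximalIdealEquivKer :
    IsLocalRing.maximalIdeal T ≃ₗ[k] LinearMap.ker (residueHom hres).toLinearMap where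
  toFun x := ⟨x, (residueHom_eq_zero hres).2 x.2⟩
  invFun x := ⟨x, (residueHom_eq_zero hres).1 x.2⟩
  map_add' _ _ := rfl
  map_smul' _ _ := rfl
  left_inv _ := rfl
  right_inv _ := rfl

theorem GL2D_le_map_redGL {D : Subgroup kˣ} {G : Subgroup (GL (Fin 2) T)}
    (h : GL2D D (IsLocalRing.ResidueField T) ≤
      G.map (Matrix.GeneralLinearGroup.map (IsLocalRing.residue T))) :
    GL2D D k ≤ G.map (redGL (residueHom hres)) := by
  intro g hg
  obtain ⟨x, hx, hxg⟩ := h (constGL_mem_GL2D (T := IsLocalRing.ResidueField T) hg)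
  refine ⟨x, hx, Units.ext (Matrix.ext fun i j => hres.injective ?_)⟩
  refine (algebraMap_residueHom hres (x i j)).trans ?_
  exact congrArg (fun y : GL (Fin 2) (IsLocalRing.ResidueField T) => y i j) hxg

theorem finrank_eq_finrank_maximalIdeal_add_one [Module.Finite k T]
    (hres : Function.Bijective (algebraMap k (IsLocalRing.ResidueField T))) :
    Module.finrank k T = Module.finrank k (IsLocalRing.maximalIdeal T) + 1 := by
  rw [(maximalIdealEquivKer hres).finrank_eq,
    ← LinearMap.finrank_range_add_finrank_ker (residueHom hres).toLinearMap, add_comm,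
    LinearMap.range_eq_top.2, finrank_top, Module.finrank_self]
  exact fun a => ⟨algebraMap k T a, by simp⟩

end ResidueField

/-! ### Passing to a conjugate containing `GL₂ᴰ(k)` -/

section Conjugate

variable {k : Type*} [Field k] {T : Type*} [CommRing T] [Algebra k T] {π : T →ₐ[k] k}
  {D : Subgroup kˣ}

theorem map_conj_le_GL2D {G : Subgroup (GL (Fin 2) T)} (hG : G ≤ GL2D D T) (P : GL (Fin 2) T) :
    G.map (MulAut.conj P).toMonoidHom ≤ GL2D D T := by
  rintro _ ⟨g, hg, rfl⟩
  have hdet : Matrix.GeneralLinearGroup.det (P * g * P⁻¹) = Matrix.GeneralLinearGroup.det g := by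
    rw [map_mul, map_mul, map_inv, mul_right_comm, mul_inv_cancel, one_mul]
  have hmem := hG hg
  rw [GL2D, Subgroup.mem_comap] at hmem ⊢
  exact hdet.symm ▸ hmem

/-- A subgroup of `GL₂ᴰ(T)` with full reduction has a conjugate containing `GL₂ᴰ(k)`. -/
theorem SquareZero.exists_conj_constGL_mem [Finite k] (hπ : SquareZero π)
    {G : Subgroup (GL (Fin 2) T)} (hG : G ≤ GL2D D T) (hGD : GL2D D k ≤ G.map (redGL π))
    (h2 : ∃ a : kˣ, (a : k) ^ 2 ≠ 1) (h4 : (2 : k) = 0 ∨ ∃ a : kˣ, (a : k) ^ 4 ≠ 1) :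
    ∃ G' : Subgroup (GL (Fin 2) T), G' ≤ GL2D D T ∧ (∀ g ∈ GL2D D k, constGL T g ∈ G') ∧
      traceSet G' = traceSet G ∧ Nonempty (G ≃* G') := by
  obtain ⟨P, -, hP⟩ := hπ.exists_conj_le hG hGD h2 h4
  refine ⟨G.map (MulAut.conj P).toMonoidHom, map_conj_le_GL2D hG P, fun g hg => ?_,
    traceSet_conj G P, ⟨(MulAut.conj P).subgroupMap G⟩⟩
  refine ⟨_, hP g hg, ?_⟩
  simp [mul_assoc]

theorem SquareZero.isStable_kernel_of_constGL_mem (hπ : SquareZero π)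
    {G : Subgroup (GL (Fin 2) T)} (hG : G ≤ GL2D D T) (hι : ∀ g ∈ GL2D D k, constGL T g ∈ G) :
    IsStable D (hπ.kernel G) :=
  hπ.isStable_kernel hG fun g hg => ⟨_, hι g hg, redGL_constGL g⟩

end Conjugate

theorem IsStable.card_parts_congr {k : Type*} [Field k] [Finite k] {R : Type*} [CommRing R]
    [Algebra k R] {D : Subgroup kˣ} {N N' : AddSubgroup (Matrix (Fin 2) (Fin 2) R)}
    (hN : IsStable D N) (h : N = N') (hN' : IsStable D N') :
    Nat.card hN.offDiag = Nat.card hN'.offDiag ∧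
      Nat.card hN.diagPart = Nat.card hN'.diagPart := by
  subst h
  exact ⟨rfl, rfl⟩

/-! ### The image in odd and in even characteristic -/

section Summary

variable {k : Type*} [Field k] [Finite k] {T : Type*} [CommRing T] [IsLocalRing T] [Algebra k T]
  [Module.Finite k T] {D : Subgroup kˣ} {G : Subgroup (GL (Fin 2) T)}

/-- The image when `2` is invertible: it is all of `GL₂ᴰ(T)`. -/
theorem image_of_two_ne_zero (p : ℕ) [Algebra (ZMod p) k]
    (hres : Function.Bijective (algebraMap k (IsLocalRing.ResidueField T)))
    (hsq : IsLocalRing.maximalIdeal T ^ 2 = ⊥) (hG : G ≤ GL2D D T)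
    (hι : ∀ g ∈ GL2D D k, constGL T g ∈ G) (h2 : ∃ a : kˣ, (a : k) ^ 2 ≠ 1) (h20 : (2 : k) ≠ 0)
    (htop : Algebra.adjoin k (traceSet G) = ⊤) :
    (traceSet G).ncard = Nat.card k ^ (Module.finrank k (IsLocalRing.maximalIdeal T) + 1) ∧
      G = GL2D D T ∧ Nonempty (GL2D D T ≃* RepSemidirect
        (copies (Module.finrank k (IsLocalRing.maximalIdeal T))
          (conjRep p D (⊤ : Ideal k)))) := by
  have hπ := squareZero_residueHom hres hsq
  have hGT := hπ.eq_GL2D_of_adjoin_eq_top hG hι (hπ.isStable_kernel_of_constGL_mem hG hι) h2 h20 htop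
  refine ⟨?_, hGT, hπ.GL2D_semidirect_equiv (maximalIdealEquivKer hres).finrank_eq⟩
  rw [hGT, traceSet_GL2D, Set.ncard_univ, Module.natCard_eq_pow_finrank (K := k),
    finrank_eq_finrank_maximalIdeal_add_one hres]

/-- The image in characteristic two. -/
theorem image_of_char_two [Algebra (ZMod 2) k] [Algebra (ZMod 2) T]
    (hres : Function.Bijective (algebraMap k (IsLocalRing.ResidueField T)))
    (hsq : IsLocalRing.maximalIdeal T ^ 2 = ⊥) (hG : G ≤ GL2D D T)
    (hι : ∀ g ∈ GL2D D k, constGL T g ∈ G) (h2 : ∃ a : kˣ, (a : k) ^ 2 ≠ 1) :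
    ∃ α β : ℕ, α ≤ Module.finrank k (IsLocalRing.maximalIdeal T) ∧
      Nat.card k ^ α * 2 ^ β ≤ Nat.card k ^ Module.finrank k (IsLocalRing.maximalIdeal T) ∧
      (traceSet G).ncard = Nat.card k ^ α * ((Nat.card k - 1) * 2 ^ β + 1) ∧
      (∃ M : Subrepresentation (conjRep 2 D (IsLocalRing.maximalIdeal T)),
        IsOfType 2 D M.toRepresentation α β ∧ Nonempty (G ≃* RepSemidirect M.toRepresentation)) ∧
      (∀ M : Subrepresentation (conjRep 2 D (IsLocalRing.maximalIdeal T)),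
        Nonempty (G ≃* RepSemidirect M.toRepresentation) →
          IsOfType 2 D M.toRepresentation α β) := by
  have hT : Finite T := Module.finite_of_finite k
  have hπ := squareZero_residueHom hres hsq
  have hN := hπ.isStable_kernel_of_constGL_mem hG hι
  obtain ⟨M, hM⟩ := exists_subrepresentation (p := 2) (I := IsLocalRing.maximalIdeal T) hN
    (fun A hA i j => (residueHom_eq_zero hres).1 (hA.1 i j))
  have hMG : Nonempty (G ≃* RepSemidirect M.toRepresentation) := by
    refine hπ.semidirect_equiv hG hι _
      ((M20 2 _).subtype.comp M.toSubmodule.subtype).toAddMonoidHom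
      (Subtype.val_injective.comp Subtype.val_injective) ?_ (fun g v => rfl)
    rw [← hM]
    ext A
    constructor
    · rintro ⟨A, rfl⟩
      exact coe_mem_matrices.2 A.2
    · intro hA
      obtain ⟨h, h'⟩ := mem_matrices.1 hA
      exact ⟨⟨⟨A, h⟩, h'⟩, rfl⟩
  obtain ⟨β, hβ, htype⟩ := isOfType_of_char_two h2 M
  have hW : ∀ M : Subrepresentation (conjRep 2 D (IsLocalRing.maximalIdeal T)),
      Nat.card (isStable_matrices M).offDiag =
        Nat.card k ^ Module.finrank k (isStable_matrices M).offDiag := fun M =>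
    Module.natCard_eq_pow_finrank
  -- The inclusion `X ⊆ 𝔪` becomes `q^α 2^β ≤ q^m`, which bounds both exponents.
  have hcard : Nat.card (isStable_matrices M).diagPart ≤
      Nat.card (IsLocalRing.maximalIdeal T) :=
    Nat.card_le_card_of_injective (fun x => ⟨x, diagPart_matrices_le x.2⟩)
      (fun x y h => Subtype.ext (congrArg
        (Subtype.val : IsLocalRing.maximalIdeal T → T) h))
  rw [hβ, hW, Module.natCard_eq_pow_finrank (K := k) (V := IsLocalRing.maximalIdeal T)] at hcard
  refine ⟨_, β, ?_, hcard, ?_, ⟨M, htype, hMG⟩, ?_⟩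
  · refine (Nat.pow_le_pow_iff_right (Finite.one_lt_card (α := k))).1 (le_trans ?_ hcard)
    exact Nat.le_mul_of_pos_right _ (by positivity)
  · have ht := hπ.ncard_traceSet_of_char_two hG hι hN h2 (two_eq_zero_of_algebra k)
    obtain ⟨h1, h3⟩ := hN.card_parts_congr hM.symm (isStable_matrices M)
    rw [ht, h1, h3, hβ, hW]
    ring
  · rintro M' ⟨e'⟩
    obtain ⟨e⟩ := hMG
    obtain ⟨h1, h3⟩ := card_parts_eq_of_equiv h2 (e.symm.trans e')
    obtain ⟨β', hβ', htype'⟩ := isOfType_of_char_two h2 M'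
    have hα : Module.finrank k (isStable_matrices M).offDiag =
        Module.finrank k (isStable_matrices M').offDiag := by
      rw [hW, hW] at h3
      exact Nat.pow_right_injective (Finite.one_lt_card (α := k)) h3
    have hββ : β = β' := by
      rw [hβ, hβ', h3] at h1
      exact Nat.pow_right_injective le_rfl (Nat.eq_of_mul_eq_mul_left Nat.card_pos h1)
    rw [hα, hββ]
    exact htype'

end Summary

end TraceImage

/-! ### The main theorem -/

theorem theorem3p1
    (p d : ℕ) [Fact p.Prime]
    -- the field with `q = p ^ d` elements
    (k : Type*) [Field k] [Algebra (ZMod p) k] (hq : Nat.card k = p ^ d)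
    (hq2 : Nat.card k ≠ 2) (hq3 : Nat.card k ≠ 3) (hq5 : Nat.card k ≠ 5)
    -- the local algebra, with the discrete topology
    (T : Type*) [CommRing T] [IsLocalRing T] [Algebra k T] [Algebra (ZMod p) T]
    [Module.Finite k T] [TopologicalSpace T] [DiscreteTopology T]
    (hres : Function.Bijective (algebraMap k (IsLocalRing.ResidueField T)))
    (hsq : IsLocalRing.maximalIdeal T ^ 2 = ⊥)
    -- the profinite group and the continuous representation
    (Γ : Type*) [Group Γ] [TopologicalSpace Γ] [IsTopologicalGroup Γ] [CompactSpace Γ]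
    [T2Space Γ] [TotallyDisconnectedSpace Γ]
    (ρ : Γ →* GL (Fin 2) T) (hρ : Continuous ρ)
    (D : Subgroup kˣ)
    (ha : ((Matrix.GeneralLinearGroup.map (IsLocalRing.residue T)).comp ρ).range =
      GL2D D (IsLocalRing.ResidueField T))
    (hb : ρ.range ≤ GL2D D T)
    (hc : Algebra.adjoin k (Set.range fun γ => (ρ γ : Matrix (Fin 2) (Fin 2) T).trace) = ⊤)
    (m t : ℕ) (hm : m = Module.finrank k (IsLocalRing.maximalIdeal T))
    (ht : t = (Set.range fun γ => (ρ γ : Matrix (Fin 2) (Fin 2) T).trace).ncard) :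
    (p ≠ 2 →
      t = (p ^ d) ^ (m + 1) ∧
      Nonempty (ρ.range ≃* RepSemidirect (copies m (conjRep p D (⊤ : Ideal k)))) ∧
      Nonempty (RepSemidirect (copies m (conjRep p D (⊤ : Ideal k))) ≃* GL2D D T)) ∧
    (p = 2 →
      ∃ α β : ℕ, α ≤ m ∧ β ≤ d * (m - α) ∧
        t = (p ^ d) ^ α * ((p ^ d - 1) * 2 ^ β + 1) ∧
        -- the exponents are determined by `t`
        (∀ α' β' : ℕ, t = (p ^ d) ^ α' * ((p ^ d - 1) * 2 ^ β' + 1) → α' = α ∧ β' = β) ∧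
        (∃ M : Subrepresentation (conjRep p D (IsLocalRing.maximalIdeal T)),
          IsOfType p D M.toRepresentation α β ∧
          Nonempty (ρ.range ≃* RepSemidirect M.toRepresentation)) ∧
        -- every submodule that gives the image is, up to isomorphism, the one given by `t`
        (∀ M : Subrepresentation (conjRep p D (IsLocalRing.maximalIdeal T)),
          Nonempty (ρ.range ≃* RepSemidirect M.toRepresentation) →
          IsOfType p D M.toRepresentation α β)) := by
  have hk : Finite k := Nat.finite_of_card_ne_zero (by
    rw [hq]
    exact pow_ne_zero _ (Fact.out : p.Prime).ne_zero)
  have hk1 : 1 < Nat.card k := Finite.one_lt_card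
  have hd : 0 < d := by
    rcases Nat.eq_zero_or_pos d with rfl | hd
    · rw [hq, pow_zero] at hk1
      omega
    · exact hd
  have h2 : ∃ a : kˣ, (a : k) ^ 2 ≠ 1 := exists_pow_ne_one 2 (by norm_num) (by omega)
  have hcharp : CharP k p := charP_of_injective_algebraMap (algebraMap (ZMod p) k).injective p
  have h20 : p ≠ 2 → (2 : k) ≠ 0 := fun hp h => by
    have : p ∣ 2 := (CharP.cast_eq_zero_iff k p 2).1 (by exact_mod_cast h)
    exact hp ((Nat.prime_dvd_prime_iff_eq Fact.out Nat.prime_two).1 this)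
  have h4 : (2 : k) = 0 ∨ ∃ a : kˣ, (a : k) ^ 4 ≠ 1 := by
    by_cases hp : p = 2
    · subst hp
      exact Or.inl (two_eq_zero_of_algebra k)
    · refine Or.inr (exists_pow_ne_one 4 (by norm_num) ?_)
      -- For odd `p` the order `4` cannot occur, so excluding `2`, `3` and `5` leaves `q > 5`,
      -- enough for an element with `a ^ 4 ≠ 1`.
      have : Nat.card k ≠ 4 := fun h => by
        have h3 : p ∣ 2 ^ 2 := by
          rw [show 2 ^ 2 = 4 from rfl, ← h, hq]
          exact dvd_pow_self p hd.ne'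
        exact hp ((Nat.prime_dvd_prime_iff_eq Fact.out Nat.prime_two).1
          ((Fact.out : p.Prime).dvd_of_dvd_pow h3))
      omega
  have hred := GL2D_le_map_redGL hres (G := ρ.range) (by rw [← ha, MonoidHom.range_comp])
  obtain ⟨G, hG, hι, htr, ⟨e⟩⟩ :=
    (squareZero_residueHom hres hsq).exists_conj_constGL_mem hb hred h2 h4
  have htrace : (Set.range fun γ => (ρ γ : Matrix (Fin 2) (Fin 2) T).trace) = traceSet ρ.range := by
    ext x
    constructor
    · rintro ⟨γ, rfl⟩
      exact ⟨_, ⟨γ, rfl⟩, rfl⟩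
    · rintro ⟨_, ⟨γ, rfl⟩, rfl⟩
      exact ⟨γ, rfl⟩
  rw [htrace, ← htr] at hc ht
  subst hm
  refine ⟨fun hp => ?_, fun hp => ?_⟩
  · obtain ⟨h1, rfl, ⟨e'⟩⟩ := image_of_two_ne_zero p hres hsq hG hι h2 (h20 hp) hc
    exact ⟨by rw [ht, h1, hq], ⟨e.trans e'⟩, ⟨e'.symm⟩⟩
  · subst hp
    obtain ⟨α, β, hα, hle, hcard, ⟨M, hM, ⟨e'⟩⟩, huniq⟩ := image_of_char_two hres hsq hG hι h2
    rw [hq] at hle hcard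
    refine ⟨α, β, hα, ?_, ht.trans hcard, fun α' β' h => ?_, ⟨M, hM, ⟨e.trans e'⟩⟩,
      fun M' ⟨e''⟩ => huniq M' ⟨e.symm.trans e''⟩⟩
    · rw [← pow_mul, ← pow_mul, ← pow_add, Nat.pow_le_pow_iff_right (by norm_num)] at hle
      rw [Nat.mul_sub]
      omega
    · exact exponents_unique hd (h.symm.trans (ht.trans hcard))
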